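/- Let $q>1$ and $0<r<\frac q2$, put $q'=\frac{q}{q-1}$ and $f(u)=e^{u^q+u^r}$, and for $x\in\mathbb R^2$ near $0$, $x\ne 0$, let \[ w=w(x):=\frac{q'}{4}|x|^2\Bigl(\log\frac1{|x|^2}+1\Bigr). \] Then there exist $R>0$ and a radially symmetric singular solution $u\in C^\infty(B_R(0)\setminus\{0\})$ of $-\Delta u=f(u)$ in $B_R(0)\setminus\{0\}\subset\mathbb R^2$ (that is, $u\ge 0$, the equation holds classically in $B_R(0)\setminus\{0\}$, and $u(x)\to\infty$ as $|x|\to0$) such that, as $x\to 0$, \[ u(x)=\Biggl[-\log w-\biggl\{-\log w-\sum_{k=0}^{n-2}\Bigl(-\frac rq\Bigr)^k(-\log w)^{(k+1)\frac rq-k}-\frac{q-1}{q}\log(-\log w)\biggr\}^{\frac rq}-\frac{q-1}{q}\log(-\log w)+\log\frac1q\Biggr]^{\frac1q} +O\left(\frac1{(-\log w)^{2-\frac1q-\frac rq}}\right), \] where $n\ge2$ is the integer with $\frac1{1-r/q}<n\le\frac1{1-r/q}+1$. -/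

import Mathlib

open Filter Topology Asymptotics
open scoped ContDiff

/-- The Euclidean plane. -/
abbrev Plane : Type := EuclideanSpace ℝ (Fin 2)

/-- The open disc of radius `R` about the origin, with the origin removed. -/
def puncturedDisc (R : ℝ) : Set Plane := Metric.ball (0 : Plane) R \ {0}

/-- `u` is a (classical) singular solution of `-Δu = f(u)` in the punctured disc of radius `R`:
it is nonnegative and of class `C²` there, satisfies the equation pointwise there,
and tends to infinity at the origin. -/
structure IsSingularSolution (f : ℝ → ℝ) (R : ℝ) (u : Plane → ℝ) : Prop where
  contDiffOn : ContDiffOn ℝ 2 u (puncturedDisc R)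
  nonneg : ∀ x ∈ puncturedDisc R, 0 ≤ u x
  equation : ∀ x ∈ puncturedDisc R, -(Laplacian.laplacian u x) = f (u x)
  tendsto : Tendsto u (𝓝[≠] (0 : Plane)) atTop

/-- `w(x) = (q'/4) |x|² (log (1/|x|²) + 1)`, where `q' = q/(q-1)`. -/
noncomputable def wFun (q : ℝ) (x : Plane) : ℝ :=
  (q / (q - 1)) / 4 * ‖x‖ ^ 2 * (Real.log (1 / ‖x‖ ^ 2) + 1)

/-- The expansion as a function of `L = -log w`:
`[L - {L - ∑_{k=0}^{n-2} (-r/q)^k L^{(k+1)r/q-k} - ((q-1)/q) log L}^{r/q}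
  - ((q-1)/q) log L + log (1/q)]^{1/q}`. -/
noncomputable def expansion (q r : ℝ) (n : ℕ) (L : ℝ) : ℝ :=
  (L
    - (L - ∑ k ∈ Finset.range (n - 1), (-(r / q)) ^ k * L ^ (((k : ℝ) + 1) * (r / q) - (k : ℝ))
        - (q - 1) / q * Real.log L) ^ (r / q)
    - (q - 1) / q * Real.log L + Real.log (1 / q)) ^ (1 / q)

/-! For radial u put t = -log |x| and u(x) = v(t). In the plane the first-order terms of the
Laplacian cancel, and the equation becomes v'' = -exp(v^q + v^r - 2t), to be solved near t = ∞ with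
v → ∞.

An approximate solution X is given through its inverse, 2t = T(X), with T = `apxTime`. Since X'' =
-4 T''(X)/T'(X)^3, the ansatz requires exp(X^q + X^r - T) ≈ 4 T''/T'^3. The leading order fixes the
logarithm and the constant in T, and the next order fixes the coefficients of X^(r-q) and X^(-q).
The residual is then O(X^(1+2r-4q)) (`apxTime_residual`).

Write v = X + φ. The linearized potential is κ/t with κ = 2(q-1)/q, up to O(t^(r/q-2))
(`linearization_sub`). The functions t^(1/4) cos(2√κ t^(1/2)) and t^(1/4) sin(2√κ t^(1/2)) solve the
linear equation exactly once 3/(16t²) is added to the potential. Their products grow like t^(1/2),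
so an error t^(r/q-2) in the potential is integrable against them exactly when r < q/2. Variation of
constants from infinity is then a contraction in the weight t^e, e = r/q - 2 + 1/q
(`exists_solution_of_decaying_perturbation`), and it yields φ = O(t^e) (`exists_emden_solution`).

In terms of L = -log w, the relation for T says that s = v^q satisfies s + s^(r/q) = L - ((q-1)/q)
log L - log q + O(L^(r/q-1)). Because r/q < 1/2, one substitution of a crude approximation of s into
s^(r/q) inverts this to the required order (`rpow_sub_expansion`), and the integer n is always 2.
The final error L^e is of the same order as the bound on φ. -/

/-! ### Tail integrals of functions with power decay. -/

section TailIntegral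

open MeasureTheory Set

variable {G : ℝ → ℝ} {t₀ C δ : ℝ}

theorem integrableOn_Ioi_of_rpow_bound (ht₀ : 0 < t₀) (hδ : 0 < δ) (hG : ContinuousOn G (Ici t₀))
    (hC : ∀ t, t₀ ≤ t → |G t| ≤ C * t ^ (-1 - δ)) {t : ℝ} (ht : t₀ ≤ t) :
    IntegrableOn G (Ioi t) := by
  have hi : IntegrableOn (fun s : ℝ => C * s ^ (-1 - δ)) (Ioi t) :=
    (integrableOn_Ioi_rpow_of_lt (by linarith) (by linarith)).const_mul C
  refine Integrable.mono' hi ?_ ?_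
  · exact (hG.mono fun s hs => ht.trans (le_of_lt hs)).aestronglyMeasurable measurableSet_Ioi
  · refine (ae_restrict_iff' measurableSet_Ioi).2 (ae_of_all _ fun s hs => ?_)
    exact hC s (ht.trans (le_of_lt hs))

theorem abs_integral_Ioi_le_of_rpow_bound (ht₀ : 0 < t₀) (hδ : 0 < δ)
    (hC : ∀ t, t₀ ≤ t → |G t| ≤ C * t ^ (-1 - δ)) {t : ℝ} (ht : t₀ ≤ t) :
    |∫ s in Ioi t, G s| ≤ C / δ * t ^ (-δ) := by
  have hi : IntegrableOn (fun s : ℝ => C * s ^ (-1 - δ)) (Ioi t) :=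
    (integrableOn_Ioi_rpow_of_lt (by linarith) (by linarith)).const_mul C
  have h : ‖∫ s in Ioi t, G s‖ ≤ ∫ s in Ioi t, C * s ^ (-1 - δ) := by
    refine norm_integral_le_of_norm_le hi ?_
    refine (ae_restrict_iff' measurableSet_Ioi).2 (ae_of_all _ fun s hs => ?_)
    exact hC s (ht.trans (le_of_lt hs))
  rw [integral_const_mul, integral_Ioi_rpow_of_lt (by linarith) (by linarith)] at h
  refine h.trans (le_of_eq ?_)
  have e1 : -1 - δ + 1 = -δ := by ring
  rw [e1]
  field_simp

theorem hasDerivAt_integral_Ioi_of_rpow_bound (ht₀ : 0 < t₀) (hδ : 0 < δ)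
    (hG : ContinuousOn G (Ici t₀)) (hC : ∀ t, t₀ ≤ t → |G t| ≤ C * t ^ (-1 - δ)) {t : ℝ}
    (ht : t₀ < t) : HasDerivAt (fun s => ∫ x in Ioi s, G x) (-G t) t := by
  have hint := fun {s : ℝ} (hs : t₀ ≤ s) => integrableOn_Ioi_of_rpow_bound ht₀ hδ hG hC hs
  have hd : HasDerivAt (fun s => (∫ x in Ioi t₀, G x) - ∫ x in t₀..s, G x) (-G t) t := by
    refine HasDerivAt.const_sub _ ?_
    refine intervalIntegral.integral_hasDerivAt_right ?_ ?_ ?_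
    · refine ContinuousOn.intervalIntegrable (hG.mono ?_)
      rw [uIcc_of_le ht.le]
      exact Icc_subset_Ici_self
    · exact ContinuousOn.stronglyMeasurableAtFilter isOpen_Ioi
        (hG.mono Ioi_subset_Ici_self) t ht
    · exact hG.continuousAt (Ici_mem_nhds ht)
  refine hd.congr_of_eventuallyEq ?_
  filter_upwards [Ioi_mem_nhds ht] with s hs
  have := intervalIntegral.integral_Ioi_sub_Ioi (hint le_rfl) (le_of_lt hs)
  linarith

end TailIntegral

/-! ### Variation of constants at infinity and contraction. -/

section FixedPoint

open MeasureTheory Set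

variable {φ₁ φ₂ φ₁' φ₂' Q : ℝ → ℝ} {H : ℝ → ℝ → ℝ} {W t₀ B e ε : ℝ}

/-- Variation of constants at infinity for a bounded, Lipschitz forcing term. -/
theorem exists_solution_of_decaying_perturbation (hW : 0 < W) (ht₀ : 0 < t₀) (hε : 0 < ε)
    (he : e < 1 / 4)
    (h₁ : ∀ t, 0 < t → HasDerivAt φ₁ (φ₁' t) t) (h₂ : ∀ t, 0 < t → HasDerivAt φ₂ (φ₂' t) t)
    (h₁' : ∀ t, 0 < t → HasDerivAt φ₁' (Q t * φ₁ t) t)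
    (h₂' : ∀ t, 0 < t → HasDerivAt φ₂' (Q t * φ₂ t) t)
    (hwr : ∀ t, 0 < t → φ₁ t * φ₂' t - φ₁' t * φ₂ t = W)
    (hb₁ : ∀ t, 0 < t → |φ₁ t| ≤ t ^ (1 / 4 : ℝ)) (hb₂ : ∀ t, 0 < t → |φ₂ t| ≤ t ^ (1 / 4 : ℝ))
    (hH : Continuous (Function.uncurry H))
    (hbd : ∀ t, t₀ ≤ t → ∀ x, |H t x| ≤ B * t ^ (e - 3 / 2 - ε))
    (hlip : ∀ t, t₀ ≤ t → ∀ x y, |H t x - H t y| ≤ B * t ^ (-(3 / 2) - ε) * |x - y|) :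
    ∃ t₁, t₀ ≤ t₁ ∧ ∃ φ φ' : ℝ → ℝ, ∀ t, t₁ < t → |φ t| ≤ t ^ e ∧ HasDerivAt φ (φ' t) t ∧
      HasDerivAt φ' (Q t * φ t + H t (φ t)) t := by
  have hB : 0 ≤ B := by
    have := (abs_nonneg _).trans (hbd t₀ le_rfl 0)
    exact nonneg_of_mul_nonneg_left this (by positivity)
  -- Chosen so that t^(1/4) · t^(e-3/2-ε) = t^(-1-δ): this is the decay of a homogeneous solution
  -- times the forcing. The hypothesis e < 1/4 makes it integrable.
  set δ : ℝ := 1 / 4 - e + ε with hδdef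
  have hδ : 0 < δ := by rw [hδdef]; linarith
  obtain ⟨t₁, ht₁, hsmall⟩ : ∃ t₁, t₀ < t₁ ∧ ∀ t, t₁ ≤ t → 2 * B / (δ * W) * t ^ (-ε) ≤ 1 / 2 := by
    have hT : Tendsto (fun t : ℝ => 2 * B / (δ * W) * t ^ (-ε)) atTop (𝓝 (2 * B / (δ * W) * 0)) :=
      (tendsto_rpow_neg_atTop hε).const_mul _
    rw [mul_zero] at hT
    have := (hT.eventually (ge_mem_nhds (show (0:ℝ) < 1 / 2 by norm_num))).and
      (eventually_gt_atTop t₀)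
    obtain ⟨t₁, h⟩ := eventually_atTop.1 this
    exact ⟨t₁, (h t₁ le_rfl).2, fun t ht => (h t ht).1⟩
  have ht₁0 : 0 < t₁ := ht₀.trans ht₁
  -- the operator for one continuous input
  have key : ∀ (φ₀ : ℝ → ℝ), (∀ t, 0 < t → ContinuousAt φ₀ t) →
      (∀ t, 0 < t → |φ₀ t| ≤ t ^ (1 / 4 : ℝ)) → ∀ g : ℝ → ℝ, ∀ D : ℝ,
      ContinuousOn g (Ici t₀) → (∀ t, t₀ ≤ t → |g t| ≤ D * t ^ (e - 3 / 2 - ε)) →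
      ContinuousOn (fun s => φ₀ s * g s) (Ici t₀) ∧
      ∀ t, t₀ ≤ t → |φ₀ t * g t| ≤ D * t ^ (-1 - δ) := by
    intro φ₀ hc hb g D hg hgb
    refine ⟨ContinuousOn.mul (fun t ht => (hc t (ht₀.trans_le ht)).continuousWithinAt) hg, ?_⟩
    intro t ht
    have ht0 : 0 < t := ht₀.trans_le ht
    have e1 : t ^ (-1 - δ) = t ^ (1 / 4 : ℝ) * t ^ (e - 3 / 2 - ε) := by
      rw [← Real.rpow_add ht0]; congr 1; rw [hδdef]; ring
    rw [abs_mul, e1]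
    calc |φ₀ t| * |g t| ≤ t ^ (1 / 4 : ℝ) * (D * t ^ (e - 3 / 2 - ε)) :=
          mul_le_mul (hb t ht0) (hgb t ht) (abs_nonneg _) (by positivity)
      _ = _ := by ring
  have hc₁ : ∀ t, 0 < t → ContinuousAt φ₁ t := fun t ht => (h₁ t ht).continuousAt
  have hc₂ : ∀ t, 0 < t → ContinuousAt φ₂ t := fun t ht => (h₂ t ht).continuousAt
  -- Both integrals run from t to infinity, so no homogeneous part is left over. The result gains a
  -- factor t^(-ε) over the weight t^e, and `S'` is its derivative because the boundary terms
  -- cancel.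
  let S : (ℝ → ℝ) → ℝ → ℝ := fun g t =>
    W⁻¹ * (φ₁ t * (∫ s in Ioi t, φ₂ s * g s) - φ₂ t * (∫ s in Ioi t, φ₁ s * g s))
  let S' : (ℝ → ℝ) → ℝ → ℝ := fun g t =>
    W⁻¹ * (φ₁' t * (∫ s in Ioi t, φ₂ s * g s) - φ₂' t * (∫ s in Ioi t, φ₁ s * g s))
  have hS : ∀ g : ℝ → ℝ, ∀ D : ℝ, ContinuousOn g (Ici t₀) →
      (∀ t, t₀ ≤ t → |g t| ≤ D * t ^ (e - 3 / 2 - ε)) → ∀ t, t₀ < t →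
      |S g t| ≤ 2 * D / (δ * W) * t ^ (-ε) * t ^ e ∧ HasDerivAt (S g) (S' g t) t ∧
      HasDerivAt (S' g) (Q t * S g t + g t) t := by
    intro g D hg hgb t ht
    have ht0 : 0 < t := ht₀.trans ht
    obtain ⟨k1, k1'⟩ := key φ₁ hc₁ hb₁ g D hg hgb
    obtain ⟨k2, k2'⟩ := key φ₂ hc₂ hb₂ g D hg hgb
    have d1 := hasDerivAt_integral_Ioi_of_rpow_bound ht₀ hδ k1 k1' ht
    have d2 := hasDerivAt_integral_Ioi_of_rpow_bound ht₀ hδ k2 k2' ht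
    have b1 := abs_integral_Ioi_le_of_rpow_bound ht₀ hδ k1' ht.le
    have b2 := abs_integral_Ioi_le_of_rpow_bound ht₀ hδ k2' ht.le
    refine ⟨?_, ?_, ?_⟩
    · have e1 : t ^ (-ε) * t ^ e = t ^ (1 / 4 : ℝ) * t ^ (-δ) := by
        rw [← Real.rpow_add ht0, ← Real.rpow_add ht0]; congr 1; rw [hδdef]; ring
      have m1 : |φ₁ t * (∫ s in Ioi t, φ₂ s * g s)| ≤ t ^ (1 / 4 : ℝ) * (D / δ * t ^ (-δ)) := by
        rw [abs_mul]
        exact mul_le_mul (hb₁ t ht0) b2 (abs_nonneg _) (by positivity)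
      have m2 : |φ₂ t * (∫ s in Ioi t, φ₁ s * g s)| ≤ t ^ (1 / 4 : ℝ) * (D / δ * t ^ (-δ)) := by
        rw [abs_mul]
        exact mul_le_mul (hb₂ t ht0) b1 (abs_nonneg _) (by positivity)
      have m3 := (abs_sub _ _).trans (add_le_add m1 m2)
      simp only [S]
      rw [abs_mul, abs_of_pos (inv_pos.2 hW), mul_assoc, e1]
      calc W⁻¹ * _ ≤ W⁻¹ * _ := mul_le_mul_of_nonneg_left m3 (inv_pos.2 hW).le
        _ = _ := by field_simp; ring
    · refine ((((h₁ t ht0).mul d2).sub ((h₂ t ht0).mul d1)).const_mul W⁻¹).congr_deriv ?_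
      simp only [S']; ring
    · refine ((((h₁' t ht0).mul d2).sub ((h₂' t ht0).mul d1)).const_mul W⁻¹).congr_deriv ?_
      have hw := hwr t ht0
      have : g t = W⁻¹ * ((φ₁ t * φ₂' t - φ₁' t * φ₂ t) * g t) := by
        rw [hw]; field_simp
      simp only [S]
      linear_combination -this
  have hgc : ∀ χ : BoundedContinuousFunction ℝ ℝ,
      ContinuousOn (fun s => H s (s ^ e * χ s)) (Ici t₀) := by
    intro χ
    refine hH.comp_continuousOn (f := fun s : ℝ => (s, s ^ e * χ s)) ?_
    refine continuousOn_id.prodMk (ContinuousOn.mul ?_ χ.continuous.continuousOn)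
    exact ContinuousOn.rpow_const continuousOn_id
      fun x hx => Or.inl (ht₀.trans_le hx).ne'
  have hSd := fun χ : BoundedContinuousFunction ℝ ℝ =>
    hS (fun s => H s (s ^ e * χ s)) B (hgc χ) (fun t ht => hbd t ht _)
  have hmax : ∀ t : ℝ, t₀ < max t t₁ := fun t => ht₁.trans_le (le_max_right _ _)
  -- Used twice: with D = 1 for boundedness of the fixed-point map, and with D the distance of two
  -- inputs for the contraction factor 1/2.
  have hscale : ∀ t y D : ℝ, t₁ ≤ t → 0 ≤ D → |y| ≤ 2 * (B * D) / (δ * W) * t ^ (-ε) * t ^ e →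
      |(t ^ e)⁻¹ * y| ≤ 1 / 2 * D := by
    intro t y D ht hD hy
    have ht0 : 0 < t := ht₁0.trans_le ht
    have hp : 0 < t ^ e := by positivity
    rw [abs_mul, abs_of_pos (inv_pos.2 hp), inv_mul_le_iff₀ hp]
    calc |y| ≤ _ := hy
      _ = t ^ e * ((2 * B / (δ * W) * t ^ (-ε)) * D) := by ring
      _ ≤ _ := by gcongr; exact hsmall t ht
  -- The unknown is χ = t^(-e) φ, so the weighted norm becomes the sup norm. Freezing the argument
  -- at `max t t₁` gives functions on the whole line, and only t > t₁ matters.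
  let F : BoundedContinuousFunction ℝ ℝ → BoundedContinuousFunction ℝ ℝ := fun χ =>
    BoundedContinuousFunction.ofNormedAddCommGroup
      (fun t => ((max t t₁) ^ e)⁻¹ * S (fun s => H s (s ^ e * χ s)) (max t t₁))
      (by
        refine continuous_iff_continuousAt.2 fun t => ?_
        have cm : ContinuousAt (fun t : ℝ => max t t₁) t :=
          (continuous_id.max continuous_const).continuousAt
        have hm0 : (0:ℝ) < max t t₁ := ht₀.trans (hmax t)
        refine ContinuousAt.mul (ContinuousAt.inv₀ (cm.rpow_const (Or.inl hm0.ne'))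
          (Real.rpow_pos_of_pos hm0 e).ne') ?_
        exact ContinuousAt.comp (f := fun t : ℝ => max t t₁)
          ((hSd χ _ (hmax t)).2.1.continuousAt) cm)
      (1 / 2 * 1)
      (fun t => hscale _ _ 1 (le_max_right _ _) zero_le_one
        (by rw [mul_one]; exact (hSd χ _ (hmax t)).1))
  have hcontr : ContractingWith (1 / 2 : NNReal) F := by
    refine ⟨by rw [← NNReal.coe_lt_coe]; norm_num, LipschitzWith.of_dist_le_mul fun χ₁ χ₂ => ?_⟩
    refine (BoundedContinuousFunction.dist_le (by positivity)).2 fun t => ?_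
    have hd := hS (fun s => H s (s ^ e * χ₁ s) - H s (s ^ e * χ₂ s)) (B * dist χ₁ χ₂)
      ((hgc χ₁).sub (hgc χ₂)) (by
        intro s hs
        have hs0 : 0 < s := ht₀.trans_le hs
        refine (hlip s hs _ _).trans ?_
        rw [← mul_sub, abs_mul, abs_of_pos (Real.rpow_pos_of_pos hs0 e)]
        have hc := BoundedContinuousFunction.dist_coe_le_dist (f := χ₁) (g := χ₂) s
        rw [Real.dist_eq] at hc
        have e1 : s ^ (e - 3 / 2 - ε) = s ^ (-(3 / 2) - ε) * s ^ e := by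
          rw [← Real.rpow_add hs0]; congr 1; ring
        rw [e1]
        calc B * s ^ (-(3 / 2) - ε) * (s ^ e * |χ₁ s - χ₂ s|)
            ≤ B * s ^ (-(3 / 2) - ε) * (s ^ e * dist χ₁ χ₂) := by gcongr
          _ = _ := by ring) (max t t₁) (hmax t)
    have hlin : S (fun s => H s (s ^ e * χ₁ s) - H s (s ^ e * χ₂ s)) (max t t₁)
        = S (fun s => H s (s ^ e * χ₁ s)) (max t t₁)
          - S (fun s => H s (s ^ e * χ₂ s)) (max t t₁) := by
      have I : ∀ (φ₀ : ℝ → ℝ), (∀ t, 0 < t → ContinuousAt φ₀ t) →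
          (∀ t, 0 < t → |φ₀ t| ≤ t ^ (1 / 4 : ℝ)) →
          ∀ χ : BoundedContinuousFunction ℝ ℝ,
          IntegrableOn (fun s => φ₀ s * H s (s ^ e * χ s)) (Ioi (max t t₁)) := by
        intro φ₀ hc hb χ
        obtain ⟨k, k'⟩ := key φ₀ hc hb (fun s => H s (s ^ e * χ s)) B (hgc χ)
          (fun t ht => hbd t ht _)
        exact integrableOn_Ioi_of_rpow_bound ht₀ hδ k k' (hmax t).le
      simp only [S, mul_sub]
      rw [integral_sub (I φ₁ hc₁ hb₁ χ₁) (I φ₁ hc₁ hb₁ χ₂),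
        integral_sub (I φ₂ hc₂ hb₂ χ₁) (I φ₂ hc₂ hb₂ χ₂)]
      ring
    have := hscale (max t t₁) _ _ (le_max_right _ _) dist_nonneg hd.1
    rw [hlin, mul_sub] at this
    rw [Real.dist_eq]
    exact le_trans this (le_of_eq (by simp))
  have hfix : F (hcontr.fixedPoint F) = hcontr.fixedPoint F := hcontr.fixedPoint_isFixedPt
  set χ := hcontr.fixedPoint F
  set g : ℝ → ℝ := fun s => H s (s ^ e * χ s) with hg
  have hχ : ∀ t, t₁ < t → t ^ e * χ t = S g t := by
    intro t ht
    have hp : 0 < t ^ e := Real.rpow_pos_of_pos (ht₁0.trans ht) e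
    have h0 : χ t = (t ^ e)⁻¹ * S g t := by
      have h := congrArg (fun f : BoundedContinuousFunction ℝ ℝ => f t) hfix
      simp only [F, BoundedContinuousFunction.coe_ofNormedAddCommGroup, max_eq_left ht.le] at h
      exact h.symm
    rw [h0]; field_simp
  refine ⟨t₁, ht₁.le, S g, S' g, fun t ht => ?_⟩
  have ht0 : 0 < t := ht₁0.trans ht
  obtain ⟨a1, a2, a3⟩ := hSd χ t (ht₁.trans ht)
  refine ⟨?_, a2, ?_⟩
  · have hp : 0 < t ^ e := by positivity
    refine a1.trans ?_
    have := hsmall t ht.le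
    nlinarith
  · refine a3.congr_deriv ?_
    rw [← hχ t ht]

end FixedPoint

/-! ### The explicit oscillator with potential κ/t + 3/(16t²). -/

section Oscillator

variable {κ t : ℝ}

theorem hasDerivAt_sqrt_phase (ht : 0 < t) :
    HasDerivAt (fun t : ℝ => 2 * √κ * t ^ (1 / 2 : ℝ)) (√κ * t ^ (-(1 / 2) : ℝ)) t := by
  refine ((Real.hasDerivAt_rpow_const (p := 1 / 2) (Or.inl ht.ne')).const_mul
    (2 * √κ)).congr_deriv ?_
  rw [show (1 / 2 - 1 : ℝ) = -(1 / 2) by norm_num]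
  ring

theorem hasDerivAt_rpow_mul_of_phase (ht : 0 < t) {c s : ℝ → ℝ} {k : ℝ}
    (hc : ∀ x, HasDerivAt c (k * s x) x) (p : ℝ) :
    HasDerivAt (fun t : ℝ => t ^ p * c (2 * √κ * t ^ (1 / 2 : ℝ)))
      (p * t ^ (p - 1) * c (2 * √κ * t ^ (1 / 2 : ℝ))
        + k * √κ * t ^ (p - 1 / 2) * s (2 * √κ * t ^ (1 / 2 : ℝ))) t := by
  refine ((Real.hasDerivAt_rpow_const (p := p) (Or.inl ht.ne')).mul
    ((hc _).comp t (hasDerivAt_sqrt_phase ht))).congr_deriv ?_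
  rw [show p - 1 / 2 = p + -(1 / 2) by ring, Real.rpow_add ht]
  simp only [Function.comp]
  ring

/-- The amplitude t^(1/4) is the WKB amplitude for the phase 2√κ t^(1/2): it makes the terms in s
cancel. What remains of its own second derivative is the term 3/(16t²). The sign k = ±1 treats
cosine and sine together. -/
theorem hasDerivAt_oscillator (hκ : 0 < κ) (ht : 0 < t) {c s : ℝ → ℝ} {k : ℝ} (hk : k * k = 1)
    (hc : ∀ x, HasDerivAt c (k * s x) x) (hs : ∀ x, HasDerivAt s (-k * c x) x) :
    HasDerivAt (fun t : ℝ =>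
      1 / 4 * (t ^ (-(3 / 4) : ℝ) * c (2 * √κ * t ^ (1 / 2 : ℝ)))
        + k * √κ * (t ^ (-(1 / 4) : ℝ) * s (2 * √κ * t ^ (1 / 2 : ℝ))))
      ((-(κ / t) - 3 / 16 / t ^ 2) * (t ^ (1 / 4 : ℝ) * c (2 * √κ * t ^ (1 / 2 : ℝ)))) t := by
  refine (((hasDerivAt_rpow_mul_of_phase ht hc (-(3 / 4))).const_mul (1 / 4)).add
    ((hasDerivAt_rpow_mul_of_phase ht hs (-(1 / 4))).const_mul (k * √κ))).congr_deriv ?_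
  have hsq : √κ * √κ = κ := Real.mul_self_sqrt hκ.le
  have e1 : t ^ (1 / 4 : ℝ) = t ^ (-(3 / 4) : ℝ) * t := by
    rw [← Real.rpow_add_one ht.ne']; norm_num
  have e2 : t ^ (-(3 / 4) - 1 : ℝ) = t ^ (-(3 / 4) : ℝ) / t := Real.rpow_sub_one ht.ne' _
  have e3 : t ^ (-(3 / 4) - 1 / 2 : ℝ) = t ^ (-(1 / 4) - 1 : ℝ) := by norm_num
  have e4 : t ^ (-(1 / 4) - 1 / 2 : ℝ) = t ^ (-(3 / 4) : ℝ) := by norm_num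
  rw [e1, e2, e3, e4]
  generalize c (2 * √κ * t ^ (1 / 2 : ℝ)) = x
  generalize s (2 * √κ * t ^ (1 / 2 : ℝ)) = y
  generalize t ^ (-(3 / 4) : ℝ) = u
  have : k * √κ * (-(1 / 4) * t ^ (-(1 / 4) - 1 : ℝ) * y + -k * √κ * u * x)
      = -(k * √κ / 4 * t ^ (-(1 / 4) - 1 : ℝ) * y) - (k * k) * (√κ * √κ) * u * x := by ring
  rw [this, hk, hsq]
  field_simp
  ring

theorem exists_solution_near_oscillator {H : ℝ → ℝ → ℝ} {t₀ B e ε : ℝ} (hκ : 0 < κ) (ht₀ : 0 < t₀)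
    (hε : 0 < ε) (he : e < 1 / 4) (hH : Continuous (Function.uncurry H))
    (hbd : ∀ t, t₀ ≤ t → ∀ x, |H t x| ≤ B * t ^ (e - 3 / 2 - ε))
    (hlip : ∀ t, t₀ ≤ t → ∀ x y, |H t x - H t y| ≤ B * t ^ (-(3 / 2) - ε) * |x - y|) :
    ∃ t₁, t₀ ≤ t₁ ∧ ∃ φ φ' : ℝ → ℝ, ∀ t, t₁ < t → |φ t| ≤ t ^ e ∧ HasDerivAt φ (φ' t) t ∧
      HasDerivAt φ' ((-(κ / t) - 3 / 16 / t ^ 2) * φ t + H t (φ t)) t := by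
  have hcos : ∀ x, HasDerivAt Real.cos ((-1) * Real.sin x) x := fun x =>
    (Real.hasDerivAt_cos x).congr_deriv (by ring)
  have hsin : ∀ x, HasDerivAt Real.sin (1 * Real.cos x) x := fun x =>
    (Real.hasDerivAt_sin x).congr_deriv (by ring)
  have hbound : ∀ (c : ℝ → ℝ), (∀ x, |c x| ≤ 1) → ∀ t : ℝ, 0 < t →
      |t ^ (1 / 4 : ℝ) * c (2 * √κ * t ^ (1 / 2 : ℝ))| ≤ t ^ (1 / 4 : ℝ) := by
    intro c hc t ht
    rw [abs_mul, abs_of_pos (Real.rpow_pos_of_pos ht _)]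
    exact mul_le_of_le_one_right (by positivity) (hc _)
  have hfirst : ∀ (c s : ℝ → ℝ) (k : ℝ), (∀ x, HasDerivAt c (k * s x) x) → ∀ t : ℝ, 0 < t →
      HasDerivAt (fun t : ℝ => t ^ (1 / 4 : ℝ) * c (2 * √κ * t ^ (1 / 2 : ℝ)))
        (1 / 4 * (t ^ (-(3 / 4) : ℝ) * c (2 * √κ * t ^ (1 / 2 : ℝ)))
        + k * √κ * (t ^ (-(1 / 4) : ℝ) * s (2 * √κ * t ^ (1 / 2 : ℝ)))) t := by
    intro c s k hc t ht
    refine (hasDerivAt_rpow_mul_of_phase ht hc (1 / 4)).congr_deriv ?_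
    norm_num
    ring
  -- The Wronskian is √κ: the phase has derivative √κ t^(-1/2), which the squared amplitude t^(1/2)
  -- cancels.
  refine exists_solution_of_decaying_perturbation (W := √κ) (Real.sqrt_pos.2 hκ) ht₀ hε he
    (hfirst Real.cos Real.sin (-1) hcos) (hfirst Real.sin Real.cos 1 hsin)
    (fun t ht => hasDerivAt_oscillator hκ ht (by norm_num) hcos
      (fun x => (hsin x).congr_deriv (by ring)))
    (fun t ht => hasDerivAt_oscillator hκ ht (by norm_num) hsin
      (fun x => (hcos x).congr_deriv (by ring)))
    ?_ (hbound _ Real.abs_cos_le_one) (hbound _ Real.abs_sin_le_one) hH hbd hlip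
  intro t ht
  have e1 : t ^ (1 / 4 : ℝ) * t ^ (-(1 / 4) : ℝ) = 1 := by
    rw [← Real.rpow_add ht]; norm_num
  have := Real.cos_sq_add_sin_sq (2 * √κ * t ^ (1 / 2 : ℝ))
  generalize Real.cos (2 * √κ * t ^ (1 / 2 : ℝ)) = x at *
  generalize Real.sin (2 * √κ * t ^ (1 / 2 : ℝ)) = y at *
  linear_combination (√κ * (x ^ 2 + y ^ 2)) * e1 + √κ * this

end Oscillator

/-! ### Calculus of first-order expansions modulo O. -/

section BigO

variable {α : Type*} {l : Filter α} {f g y z w : α → ℝ}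

theorem isBigO_comp_sub_of_hasDerivAt {F : ℝ → ℝ} {F' c : ℝ} (hF : HasDerivAt F F' c)
    (hz : Tendsto z l (𝓝 0)) (hy : (fun i => y i - c) =O[l] z) :
    (fun i => F (y i) - F c) =O[l] z := by
  have h1 : Tendsto y l (𝓝 c) := by
    have := (hy.trans_tendsto hz).add_const c
    simpa using this
  exact ((hF.isBigO_sub).comp_tendsto h1).trans hy

theorem isBigO_rpow_sub_one (p : ℝ) (hz : Tendsto z l (𝓝 0)) (hf : (fun i => f i - 1) =O[l] z) :
    (fun i => f i ^ p - 1) =O[l] z := by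
  have := isBigO_comp_sub_of_hasDerivAt (F := fun x : ℝ => x ^ p)
    (Real.hasDerivAt_rpow_const (p := p) (Or.inl one_ne_zero)) hz hf
  simpa using this

theorem isBigO_exp_sub_one (hz : Tendsto z l (𝓝 0)) (hf : f =O[l] z) :
    (fun i => Real.exp (f i) - 1) =O[l] z := by
  have := isBigO_comp_sub_of_hasDerivAt (F := Real.exp) (c := 0) (Real.hasDerivAt_exp 0) hz
    (y := f) (by simpa using hf)
  simpa using this

theorem isBigO_log (hz : Tendsto z l (𝓝 0)) (hf : (fun i => f i - 1) =O[l] z) :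
    (fun i => Real.log (f i)) =O[l] z := by
  have := isBigO_comp_sub_of_hasDerivAt (F := Real.log)
    (Real.hasDerivAt_log one_ne_zero) hz hf
  simpa using this

theorem isBigO_mul_sub_one (hz : Tendsto z l (𝓝 0)) (hf : (fun i => f i - 1) =O[l] z)
    (hg : (fun i => g i - 1) =O[l] z) : (fun i => f i * g i - 1) =O[l] z := by
  have hz1 : z =O[l] (fun _ => (1 : ℝ)) := hz.isBigO_one ℝ
  have h1 : (fun i => (f i - 1) * (g i - 1)) =O[l] z := by
    simpa using hf.mul (hg.trans hz1)
  refine ((h1.add hf).add hg).congr_left fun i => ?_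
  ring

theorem isBigO_inv_sub_one (hz : Tendsto z l (𝓝 0)) (hf : (fun i => f i - 1) =O[l] z) :
    (fun i => (f i)⁻¹ - 1) =O[l] z := by
  have := isBigO_comp_sub_of_hasDerivAt (F := fun x : ℝ => x⁻¹)
    (hasDerivAt_inv one_ne_zero) hz hf
  simpa using this

theorem tendsto_one_of_isBigO (hz : Tendsto z l (𝓝 0)) (hf : (fun i => f i - 1) =O[l] z) :
    Tendsto f l (𝓝 1) := by
  simpa using (hf.trans_tendsto hz).add_const 1

/-- First order expansions in two small quantities, modulo squares, multiply. -/
theorem isBigO_sq_mul_expansion {a b a' b' : ℝ} (hz : Tendsto z l (𝓝 0)) (hw : w =O[l] z)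
    (hf : (fun i => f i - (1 + a * z i + b * w i)) =O[l] (fun i => z i ^ 2))
    (hg : (fun i => g i - (1 + a' * z i + b' * w i)) =O[l] (fun i => z i ^ 2)) :
    (fun i => f i * g i - (1 + (a + a') * z i + (b + b') * w i)) =O[l] (fun i => z i ^ 2) := by
  have hz1 : z =O[l] (fun _ => (1 : ℝ)) := hz.isBigO_one ℝ
  have hw1 : w =O[l] (fun _ => (1 : ℝ)) := hw.trans hz1
  have hzz : (fun i => z i * z i) =O[l] (fun i => z i ^ 2) := by
    simp only [sq]; exact isBigO_refl _ _
  have hzw : (fun i => z i * w i) =O[l] (fun i => z i ^ 2) := by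
    simp only [sq]; exact (isBigO_refl _ _).mul hw
  have hww : (fun i => w i * w i) =O[l] (fun i => z i ^ 2) := by
    simp only [sq]; exact hw.mul hw
  have hlin : ∀ a b : ℝ, (fun i => 1 + a * z i + b * w i) =O[l] (fun _ => (1 : ℝ)) := fun a b =>
    ((isBigO_const_const _ one_ne_zero _).add (hz1.const_mul_left _)).add (hw1.const_mul_left _)
  have hz2 : (fun i => z i ^ 2) =O[l] (fun _ => (1 : ℝ)) := by simpa using hz1.pow 2
  have h1 : (fun i => (f i - (1 + a * z i + b * w i)) * g i) =O[l] (fun i => z i ^ 2) := by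
    have hg1 : g =O[l] (fun _ => (1 : ℝ)) := by
      refine ((hg.trans hz2).add (hlin a' b')).congr_left fun i => ?_
      ring
    simpa using hf.mul hg1
  have h2 : (fun i => (1 + a * z i + b * w i) * (g i - (1 + a' * z i + b' * w i)))
      =O[l] (fun i => z i ^ 2) := by
    simpa using (hlin a b).mul hg
  refine ((h1.add h2).add (((hzz.const_mul_left (a * a')).add
    (hzw.const_mul_left (a * b' + b * a'))).add (hww.const_mul_left (b * b')))).congr_left fun i => ?_
  ring

theorem isBigO_sq_exp_expansion {a b : ℝ} (hz : Tendsto z l (𝓝 0)) (hw : w =O[l] z) :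
    (fun i => Real.exp (a * z i + b * w i) - (1 + a * z i + b * w i)) =O[l] (fun i => z i ^ 2) := by
  have hlin : (fun i => a * z i + b * w i) =O[l] z :=
    ((isBigO_refl _ _).const_mul_left _).add (hw.const_mul_left _)
  have h := (Real.exp_sub_sum_range_isBigO_pow 2).comp_tendsto (hlin.trans_tendsto hz)
  refine (h.trans (hlin.pow 2)).congr_left fun i => ?_
  simp [Finset.sum_range_succ]
  ring

end BigO

/-! ### The approximate solution: residual and linearization. -/

section ApproximateSolution

variable {q r : ℝ}

/-- The leading constant `4 (q - 1) / q²` of `-v''`. -/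
noncomputable def leadConst (q : ℝ) : ℝ := 4 * (q - 1) / q ^ 2

/-- With T' = q x^(q-1) D₁ and T'' = q(q-1) x^(q-2) D₂, the two coefficients are those of x^(r-q)
and x^(-q) in the first-order part of D₁^3 / D₂. This is what the exponential has to compensate. -/
noncomputable def coeffA (q r : ℝ) : ℝ := 3 * (r / q) - r * (r - 1) / (q * (q - 1))

noncomputable def coeffC (q : ℝ) : ℝ := 3 * ((2 * q - 1) / q) + (2 * q - 1) / (q * (q - 1))

/-- The approximate hodograph `2t = apxTime v` of the singular solution. -/
noncomputable def apxTime (q r x : ℝ) : ℝ :=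
  x ^ q + x ^ r + (2 * q - 1) * Real.log x - Real.log (leadConst q)
    + coeffA q r * x ^ (r - q) + coeffC q * x ^ (-q)

noncomputable def apxTimeDeriv (q r x : ℝ) : ℝ :=
  q * x ^ (q - 1) + r * x ^ (r - 1) + (2 * q - 1) * x⁻¹
    + coeffA q r * ((r - q) * x ^ (r - q - 1)) + coeffC q * (-q * x ^ (-q - 1))

noncomputable def apxTimeDeriv₂ (q r x : ℝ) : ℝ :=
  q * ((q - 1) * x ^ (q - 1 - 1)) + r * ((r - 1) * x ^ (r - 1 - 1)) + (2 * q - 1) * (-(x ^ 2)⁻¹)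
    + coeffA q r * ((r - q) * ((r - q - 1) * x ^ (r - q - 1 - 1)))
    + coeffC q * (-q * ((-q - 1) * x ^ (-q - 1 - 1)))

theorem leadConst_pos (hq : 1 < q) : 0 < leadConst q := by
  have : 0 < q - 1 := by linarith
  unfold leadConst; positivity

theorem hasDerivAt_apxTime {x : ℝ} (hx : 0 < x) :
    HasDerivAt (apxTime q r) (apxTimeDeriv q r x) x := by
  have hp := fun p : ℝ => Real.hasDerivAt_rpow_const (x := x) (p := p) (Or.inl hx.ne')
  exact (((((hp q).add (hp r)).add ((Real.hasDerivAt_log hx.ne').const_mul (2 * q - 1))).sub_const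
    _).add ((hp (r - q)).const_mul _)).add ((hp (-q)).const_mul _)

theorem hasDerivAt_apxTimeDeriv {x : ℝ} (hx : 0 < x) :
    HasDerivAt (apxTimeDeriv q r) (apxTimeDeriv₂ q r x) x := by
  have hp := fun p : ℝ => Real.hasDerivAt_rpow_const (x := x) (p := p) (Or.inl hx.ne')
  exact (((((hp (q - 1)).const_mul _).add ((hp (r - 1)).const_mul _)).add
    ((hasDerivAt_inv hx.ne').const_mul (2 * q - 1))).add
    (((hp (r - q - 1)).const_mul _).const_mul _)).add (((hp (-q - 1)).const_mul _).const_mul _)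

noncomputable def derivFactor (q r x : ℝ) : ℝ :=
  1 + r / q * x ^ (r - q) + (2 * q - 1) / q * x ^ (-q)
    + (coeffA q r * (r - q) / q * (x ^ (r - q) * x ^ (-q)) - coeffC q * (x ^ (-q) * x ^ (-q)))

noncomputable def derivFactor₂ (q r x : ℝ) : ℝ :=
  1 + r * (r - 1) / (q * (q - 1)) * x ^ (r - q) + -((2 * q - 1) / (q * (q - 1))) * x ^ (-q)
    + (coeffA q r * (r - q) * (r - q - 1) / (q * (q - 1)) * (x ^ (r - q) * x ^ (-q))
      + coeffC q * (q + 1) / (q - 1) * (x ^ (-q) * x ^ (-q)))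

theorem apxTimeDeriv_eq (hq : 1 < q) {x : ℝ} (hx : 0 < x) :
    apxTimeDeriv q r x = q * x ^ (q - 1) * derivFactor q r x := by
  have hq0 : q ≠ 0 := by linarith
  have e1 : x ^ (r - 1) = x ^ (q - 1) * x ^ (r - q) := by rw [← Real.rpow_add hx]; congr 1; ring
  have e2 : x⁻¹ = x ^ (q - 1) * x ^ (-q) := by
    rw [← Real.rpow_add hx, ← Real.rpow_neg_one]; congr 1; ring
  have e3 : x ^ (r - q - 1) = x ^ (q - 1) * (x ^ (r - q) * x ^ (-q)) := by
    rw [← Real.rpow_add hx, ← Real.rpow_add hx]; congr 1; ring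
  have e4 : x ^ (-q - 1) = x ^ (q - 1) * (x ^ (-q) * x ^ (-q)) := by
    rw [← Real.rpow_add hx, ← Real.rpow_add hx]; congr 1; ring
  unfold apxTimeDeriv derivFactor
  rw [e1, e2, e3, e4]
  field_simp
  ring

theorem apxTimeDeriv₂_eq (hq : 1 < q) {x : ℝ} (hx : 0 < x) :
    apxTimeDeriv₂ q r x = q * (q - 1) * x ^ (q - 2) * derivFactor₂ q r x := by
  have hq0 : q ≠ 0 := by linarith
  have hq1 : q - 1 ≠ 0 := by linarith
  have e0 : x ^ (q - 1 - 1) = x ^ (q - 2) := by congr 1; ring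
  have e1 : x ^ (r - 1 - 1) = x ^ (q - 2) * x ^ (r - q) := by
    rw [← Real.rpow_add hx]; congr 1; ring
  have e2 : (x ^ 2)⁻¹ = x ^ (q - 2) * x ^ (-q) := by
    rw [← Real.rpow_add hx, ← Real.rpow_natCast, ← Real.rpow_neg hx.le]; congr 1; push_cast; ring
  have e3 : x ^ (r - q - 1 - 1) = x ^ (q - 2) * (x ^ (r - q) * x ^ (-q)) := by
    rw [← Real.rpow_add hx, ← Real.rpow_add hx]; congr 1; ring
  have e4 : x ^ (-q - 1 - 1) = x ^ (q - 2) * (x ^ (-q) * x ^ (-q)) := by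
    rw [← Real.rpow_add hx, ← Real.rpow_add hx]; congr 1; ring
  unfold apxTimeDeriv₂ derivFactor₂
  rw [e0, e1, e2, e3, e4]
  field_simp
  ring

theorem exp_sub_apxTime (hq : 1 < q) {x : ℝ} (hx : 0 < x) :
    Real.exp (x ^ q + x ^ r - apxTime q r x) = leadConst q * x ^ (1 - 2 * q)
      * Real.exp (-coeffA q r * x ^ (r - q) + -coeffC q * x ^ (-q)) := by
  nth_rewrite 1 [← Real.exp_log (leadConst_pos hq)]
  rw [Real.rpow_def_of_pos hx (1 - 2 * q), ← Real.exp_add, ← Real.exp_add]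
  unfold apxTime
  congr 1
  ring

variable {α : Type*} {l : Filter α} {X V : α → ℝ}

theorem tendsto_rpow_zero_of_neg {p : ℝ} (hp : p < 0) (hX : Tendsto X l atTop) :
    Tendsto (fun i => X i ^ p) l (𝓝 0) := by
  have := (tendsto_rpow_neg_atTop (neg_pos.2 hp)).comp hX
  simpa [Function.comp_def] using this

theorem isBigO_rpow_rpow {p p' : ℝ} (hp : p ≤ p') (hX : Tendsto X l atTop) :
    (fun i => X i ^ p) =O[l] (fun i => X i ^ p') := by
  refine IsBigO.of_bound 1 ?_
  filter_upwards [hX.eventually_ge_atTop 1] with i hi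
  rw [one_mul, Real.norm_of_nonneg (by positivity), Real.norm_of_nonneg (by positivity)]
  exact Real.rpow_le_rpow_of_exponent_le hi hp

theorem isBigO_log_rpow {p : ℝ} (hp : 0 < p) (hX : Tendsto X l atTop) :
    (fun i => Real.log (X i)) =O[l] (fun i => X i ^ p) :=
  (isLittleO_log_rpow_atTop hp).isBigO.comp_tendsto hX

theorem isBigO_rpow_mul_rpow {p p' s : ℝ} (hp : p + p' ≤ s) (hX : Tendsto X l atTop) :
    (fun i => X i ^ p * X i ^ p') =O[l] (fun i => X i ^ s) := by
  refine (isBigO_rpow_rpow hp hX).congr' ?_ EventuallyEq.rfl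
  filter_upwards [hX.eventually_gt_atTop 0] with i hi
  exact Real.rpow_add hi _ _

theorem derivFactor_expansion (hr : 0 < r)
    (hX : Tendsto X l atTop) :
    (fun i => derivFactor q r (X i)
      - (1 + r / q * X i ^ (r - q) + (2 * q - 1) / q * X i ^ (-q)))
      =O[l] (fun i => X i ^ (2 * (r - q))) := by
  unfold derivFactor
  simp only [add_sub_cancel_left]
  exact ((isBigO_rpow_mul_rpow (by linarith) hX).const_mul_left _).sub
    ((isBigO_rpow_mul_rpow (by linarith) hX).const_mul_left _)

theorem derivFactor₂_expansion (hr : 0 < r)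
    (hX : Tendsto X l atTop) :
    (fun i => derivFactor₂ q r (X i) - (1 + r * (r - 1) / (q * (q - 1)) * X i ^ (r - q)
        + -((2 * q - 1) / (q * (q - 1))) * X i ^ (-q)))
      =O[l] (fun i => X i ^ (2 * (r - q))) := by
  unfold derivFactor₂
  simp only [add_sub_cancel_left]
  exact ((isBigO_rpow_mul_rpow (by linarith) hX).const_mul_left _).add
    ((isBigO_rpow_mul_rpow (by linarith) hX).const_mul_left _)

theorem tendsto_derivFactor (hr : 0 < r) (hrq : r < q / 2)
    (hX : Tendsto X l atTop) : Tendsto (fun i => derivFactor q r (X i)) l (𝓝 1) := by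
  have hz := tendsto_rpow_zero_of_neg (X := X) (show r - q < 0 by linarith) hX
  have hw := tendsto_rpow_zero_of_neg (X := X) (show -q < 0 by linarith) hX
  unfold derivFactor
  have := ((hz.const_mul (r / q)).const_add 1).add ((hw.const_mul ((2 * q - 1) / q)).add
    (((hz.mul hw).const_mul (coeffA q r * (r - q) / q)).sub ((hw.mul hw).const_mul (coeffC q))))
  simp only [mul_zero, add_zero, sub_zero] at this
  exact this.congr fun i => by ring

theorem apxTime_residual (hq : 1 < q) (hr : 0 < r) (hrq : r < q / 2) (hX : Tendsto X l atTop) :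
    (fun i => Real.exp (X i ^ q + X i ^ r - apxTime q r (X i))
      - 4 * apxTimeDeriv₂ q r (X i) / apxTimeDeriv q r (X i) ^ 3)
      =O[l] (fun i => X i ^ (1 + 2 * r - 4 * q)) := by
  have hz := tendsto_rpow_zero_of_neg (X := X) (show r - q < 0 by linarith) hX
  have hw : (fun i => X i ^ (-q)) =O[l] (fun i => X i ^ (r - q)) :=
    isBigO_rpow_rpow (by linarith) hX
  have hsq : (fun i => X i ^ (2 * (r - q))) =ᶠ[l] (fun i => (X i ^ (r - q)) ^ 2) := by
    filter_upwards [hX.eventually_gt_atTop 0] with i hi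
    rw [← Real.rpow_natCast, ← Real.rpow_mul hi.le]; congr 1; push_cast; ring
  have d1 := (derivFactor_expansion hr hX).congr' EventuallyEq.rfl hsq
  have d2 := (derivFactor₂_expansion hr hX).congr' EventuallyEq.rfl hsq
  have ex := isBigO_sq_exp_expansion (a := -coeffA q r) (b := -coeffC q) hz hw
  have d1e := isBigO_sq_mul_expansion hz hw
    (isBigO_sq_mul_expansion hz hw (isBigO_sq_mul_expansion hz hw d1 d1) d1) ex
  have hq1 : q - 1 ≠ 0 := by linarith
  have hq0 : q ≠ 0 := by linarith
  -- By the choice of `coeffA` and `coeffC` the first-order terms on both sides agree, which leaves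
  -- an error quadratic in X^(r-q).
  have hdiff : (fun i => derivFactor q r (X i) ^ 3
      * Real.exp (-coeffA q r * X i ^ (r - q) + -coeffC q * X i ^ (-q)) - derivFactor₂ q r (X i))
      =O[l] (fun i => (X i ^ (r - q)) ^ 2) := by
    refine (d1e.sub d2).congr_left fun i => ?_
    simp only [coeffA, coeffC]
    ring
  have hD := tendsto_derivFactor hr hrq hX
  have hD3 : (fun i => (derivFactor q r (X i) ^ 3)⁻¹) =O[l] (fun _ => (1 : ℝ)) := by
    have := (hD.pow 3).inv₀ (by norm_num)
    exact this.isBigO_one ℝ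
  have hmain := ((isBigO_refl (fun i => leadConst q * X i ^ (1 - 2 * q)) l).mul
    (hdiff.mul hD3))
  have h2 : (fun i => leadConst q * X i ^ (1 - 2 * q) * ((X i ^ (r - q)) ^ 2 * 1))
      =O[l] (fun i => X i ^ (1 + 2 * r - 4 * q)) := by
    have := (isBigO_rpow_mul_rpow (X := X) (p := 1 - 2 * q) (p' := 2 * (r - q))
      (s := 1 + 2 * r - 4 * q) (by linarith) hX).const_mul_left (leadConst q)
    refine this.congr' ?_ EventuallyEq.rfl
    filter_upwards [hsq] with i hi
    rw [← hi]; ring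
  refine (hmain.trans h2).congr' ?_ EventuallyEq.rfl
  filter_upwards [hX.eventually_gt_atTop 0, hD.eventually (lt_mem_nhds (zero_lt_one))] with i hi hDi
  rw [exp_sub_apxTime hq hi, apxTimeDeriv_eq hq hi, apxTimeDeriv₂_eq hq hi]
  have e1 : X i ^ (q - 2) = X i ^ (1 - 2 * q) * (X i ^ (q - 1)) ^ 3 := by
    rw [← Real.rpow_natCast, ← Real.rpow_mul hi.le, ← Real.rpow_add hi]; congr 1; push_cast; ring
  have hp : 0 < X i ^ (q - 1) := by positivity
  rw [e1]
  unfold leadConst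
  field_simp

/-- Comparison of `v ^ p` at nearby large arguments. -/
theorem isBigO_rpow_div_sub_one {s : ℝ} (p : ℝ) (hs : s < 1) (hX : Tendsto X l atTop)
    (hV : (fun i => V i - X i) =O[l] (fun i => X i ^ s)) :
    (fun i => (V i / X i) ^ p - 1) =O[l] (fun i => X i ^ (s - 1)) := by
  refine isBigO_rpow_sub_one p (tendsto_rpow_zero_of_neg (by linarith) hX) ?_
  refine (hV.mul (isBigO_refl (fun i => (X i)⁻¹) l)).congr' ?_ ?_
  · filter_upwards [hX.eventually_gt_atTop 0] with i hi
    field_simp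
  · filter_upwards [hX.eventually_gt_atTop 0] with i hi
    rw [Real.rpow_sub_one hi.ne']; field_simp

theorem eventually_pos_of_near {s : ℝ} (hs : s < 1) (hX : Tendsto X l atTop)
    (hV : (fun i => V i - X i) =O[l] (fun i => X i ^ s)) : ∀ᶠ i in l, 0 < V i := by
  have h := isBigO_rpow_div_sub_one 1 hs hX hV
  simp only [Real.rpow_one] at h
  have h1 := tendsto_one_of_isBigO (tendsto_rpow_zero_of_neg (by linarith) hX) h
  filter_upwards [h1.eventually (lt_mem_nhds zero_lt_one), hX.eventually_gt_atTop 0] with i h2 h3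
  exact (div_pos_iff_of_pos_right h3).1 h2

theorem isBigO_rpow_sub_rpow {s : ℝ} (p : ℝ) (hs : s < 1) (hX : Tendsto X l atTop)
    (hV : (fun i => V i - X i) =O[l] (fun i => X i ^ s)) :
    (fun i => V i ^ p - X i ^ p) =O[l] (fun i => X i ^ (p + s - 1)) := by
  refine ((isBigO_refl (fun i => X i ^ p) l).mul (isBigO_rpow_div_sub_one p hs hX hV)).congr' ?_ ?_
  · filter_upwards [hX.eventually_gt_atTop 0, eventually_pos_of_near hs hX hV] with i hi hv
    rw [Real.div_rpow hv.le hi.le]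
    have : 0 < X i ^ p := by positivity
    field_simp
  · filter_upwards [hX.eventually_gt_atTop 0] with i hi
    rw [← Real.rpow_add hi]; congr 1; ring

theorem apxTime_div_sub_one (hr : 0 < r) (hrq : r < q / 2) (hX : Tendsto X l atTop) :
    (fun i => apxTime q r (X i) / X i ^ q - 1) =O[l] (fun i => X i ^ (r - q)) := by
  have h0 : (fun i => X i ^ (0:ℝ)) =O[l] (fun i => X i ^ r) := isBigO_rpow_rpow hr.le hX
  simp only [Real.rpow_zero] at h0
  have h : (fun i => X i ^ r + (2 * q - 1) * Real.log (X i) - Real.log (leadConst q)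
    + coeffA q r * X i ^ (r - q) + coeffC q * X i ^ (-q)) =O[l] (fun i => X i ^ r) := by
    refine ((((isBigO_refl _ _).add ((isBigO_log_rpow hr hX).const_mul_left _)).sub ?_).add
      ((isBigO_rpow_rpow (by linarith) hX).const_mul_left _)).add
      ((isBigO_rpow_rpow (by linarith) hX).const_mul_left _)
    exact (isBigO_const_const _ one_ne_zero _).trans h0
  refine (h.mul (isBigO_refl (fun i => (X i ^ q)⁻¹) l)).congr' ?_ ?_
  · filter_upwards [hX.eventually_gt_atTop 0] with i hi
    have : 0 < X i ^ q := by positivity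
    unfold apxTime
    field_simp
    ring
  · filter_upwards [hX.eventually_gt_atTop 0] with i hi
    rw [Real.rpow_sub hi]; rfl

/-- A perturbation of size X^(r-2q+1) changes X^q by about X^(q-1) · X^(r-2q+1) = X^(r-q), and X^r
by less. This is the relative accuracy used throughout the linearization. -/
theorem nonlinearity_sub (hr : 0 < r) (hrq : r < q / 2) (hX : Tendsto X l atTop)
    (hV : (fun i => V i - X i) =O[l] (fun i => X i ^ (r - 2 * q + 1))) :
    (fun i => (V i ^ q + V i ^ r) - (X i ^ q + X i ^ r)) =O[l] (fun i => X i ^ (r - q)) := by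
  have h1 := (isBigO_rpow_sub_rpow q (by linarith) hX hV).trans
    (isBigO_rpow_rpow (p' := r - q) (by linarith) hX)
  have h2 := (isBigO_rpow_sub_rpow r (by linarith) hX hV).trans
    (isBigO_rpow_rpow (p' := r - q) (by linarith) hX)
  refine (h1.add h2).congr_left fun i => ?_
  ring

/-- The linearization of the equation near the approximate solution. -/
theorem linearization_sub (hq : 1 < q) (hr : 0 < r) (hrq : r < q / 2) (hX : Tendsto X l atTop)
    (hV : (fun i => V i - X i) =O[l] (fun i => X i ^ (r - 2 * q + 1))) :
    (fun i => (q * V i ^ (q - 1) + r * V i ^ (r - 1))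
        * Real.exp (V i ^ q + V i ^ r - apxTime q r (X i))
        - q * leadConst q / apxTime q r (X i)) =O[l] (fun i => X i ^ (r - 2 * q)) := by
  have hq0 : q ≠ 0 := by linarith
  have hz := tendsto_rpow_zero_of_neg (X := X) (show r - q < 0 by linarith) hX
  have hw : (fun i => X i ^ (-q)) =O[l] (fun i => X i ^ (r - q)) :=
    isBigO_rpow_rpow (by linarith) hX
  have hrel : ∀ p : ℝ, (fun i => (V i / X i) ^ p - 1) =O[l] (fun i => X i ^ (r - q)) := fun p =>
    (isBigO_rpow_div_sub_one p (by linarith) hX hV).trans (isBigO_rpow_rpow (by linarith) hX)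
  have hfac : (fun i => ((V i / X i) ^ (q - 1) + r / q * X i ^ (r - q) * (V i / X i) ^ (r - 1)) - 1)
      =O[l] (fun i => X i ^ (r - q)) := by
    have h1 : (fun i => r / q * X i ^ (r - q) * (V i / X i) ^ (r - 1))
        =O[l] (fun i => X i ^ (r - q)) := by
      have := ((isBigO_refl (fun i => X i ^ (r - q)) l).const_mul_left (r / q)).mul
        ((tendsto_one_of_isBigO hz (hrel (r - 1))).isBigO_one ℝ)
      simpa using this
    refine ((hrel (q - 1)).add h1).congr_left fun i => ?_
    ring
  have hexp : (fun i => Real.exp ((V i ^ q + V i ^ r) - (X i ^ q + X i ^ r)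
      + (-coeffA q r * X i ^ (r - q) + -coeffC q * X i ^ (-q))) - 1)
      =O[l] (fun i => X i ^ (r - q)) :=
    isBigO_exp_sub_one hz ((nonlinearity_sub hr hrq hX hV).add
      (((isBigO_refl _ _).const_mul_left _).add (hw.const_mul_left _)))
  have hinv := isBigO_inv_sub_one hz (apxTime_div_sub_one hr hrq hX)
  have hdiff := ((isBigO_mul_sub_one hz hfac hexp).sub hinv)
  -- Both quantities compared equal q · `leadConst q` · X^(-q) times a factor 1 + O(X^(r-q)).
  have h := ((isBigO_refl (fun i => X i ^ (-q)) l).const_mul_left (q * leadConst q)).mul hdiff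
  refine (h.trans (isBigO_rpow_mul_rpow (s := r - 2 * q) (by linarith) hX)).congr' ?_
    EventuallyEq.rfl
  filter_upwards [hX.eventually_gt_atTop 0, eventually_pos_of_near (by linarith) hX hV] with i hi hv
  have e1 : Real.exp (V i ^ q + V i ^ r - apxTime q r (X i)) = leadConst q * X i ^ (1 - 2 * q)
      * Real.exp ((V i ^ q + V i ^ r) - (X i ^ q + X i ^ r)
        + (-coeffA q r * X i ^ (r - q) + -coeffC q * X i ^ (-q))) := by
    rw [Real.exp_add _ (-coeffA q r * X i ^ (r - q) + -coeffC q * X i ^ (-q))]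
    have := exp_sub_apxTime (r := r) hq hi
    have e2 : V i ^ q + V i ^ r - apxTime q r (X i) = ((V i ^ q + V i ^ r) - (X i ^ q + X i ^ r))
      + (X i ^ q + X i ^ r - apxTime q r (X i)) := by ring
    rw [e2, Real.exp_add, this]
    ring
  have p1 : 0 < X i ^ (q - 1) := by positivity
  have p2 : 0 < X i ^ (r - 1) := by positivity
  have e3 : X i ^ (r - q) = X i ^ (r - 1) / X i ^ (q - 1) := by
    rw [← Real.rpow_sub hi]; congr 1; ring
  have e4 : X i ^ (1 - 2 * q) = X i ^ (-q) / X i ^ (q - 1) := by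
    rw [← Real.rpow_sub hi]; congr 1; ring
  have e5 : (apxTime q r (X i) / X i ^ q)⁻¹ = X i ^ q / apxTime q r (X i) := inv_div _ _
  have e6 : X i ^ (-q) * X i ^ q = 1 := by rw [← Real.rpow_add hi]; simp
  have e7 : (q * V i ^ (q - 1) + r * V i ^ (r - 1)) = q * X i ^ (q - 1) *
      ((V i / X i) ^ (q - 1) + r / q * X i ^ (r - q) * (V i / X i) ^ (r - 1)) := by
    rw [Real.div_rpow hv.le hi.le, Real.div_rpow hv.le hi.le, e3]
    field_simp
  rw [e1, e5, e7, e4]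
  generalize ((V i / X i) ^ (q - 1) + r / q * X i ^ (r - q) * (V i / X i) ^ (r - 1)) = m
  generalize Real.exp _ = E
  have e8 : q * X i ^ (q - 1) * m * (leadConst q * (X i ^ (-q) / X i ^ (q - 1)) * E)
      = q * leadConst q * X i ^ (-q) * (m * E) := by field_simp
  rw [e8]
  linear_combination (-(q * leadConst q / apxTime q r (X i))) * e6

end ApproximateSolution

/-! ### Inverting the approximate hodograph. -/

section InverseFunction

variable {q r : ℝ}

theorem tendsto_apxTime_atTop (hr : 0 < r) (hrq : r < q / 2) :
    Tendsto (apxTime q r) atTop atTop := by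
  have h1 := tendsto_one_of_isBigO (tendsto_rpow_zero_of_neg (show r - q < 0 by linarith) tendsto_id)
    (apxTime_div_sub_one hr hrq tendsto_id)
  have h2 := h1.pos_mul_atTop zero_lt_one (tendsto_rpow_atTop (show 0 < q by linarith))
  refine h2.congr' ?_
  filter_upwards [eventually_gt_atTop 0] with x hx
  have : 0 < x ^ q := by positivity
  simp only [id]
  field_simp

theorem eventually_apxTimeDeriv_pos (hq : 1 < q) (hr : 0 < r) (hrq : r < q / 2) :
    ∀ᶠ x in atTop, 0 < apxTimeDeriv q r x := by
  filter_upwards [(tendsto_derivFactor hr hrq tendsto_id).eventually (lt_mem_nhds zero_lt_one),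
    eventually_gt_atTop 0] with x h1 h2
  rw [apxTimeDeriv_eq hq h2]
  simp only [id] at h1
  positivity

/-- The approximate solution, as the inverse function of `apxTime / 2`. -/
theorem exists_apxSolution (hq : 1 < q) (hr : 0 < r) (hrq : r < q / 2) :
    ∃ t₀ : ℝ, 0 < t₀ ∧ ∃ X : ℝ → ℝ, Tendsto X atTop atTop ∧ ∀ t, t₀ < t →
      0 < X t ∧ apxTimeDeriv q r (X t) ≠ 0 ∧ apxTime q r (X t) = 2 * t ∧
      HasDerivAt X (2 / apxTimeDeriv q r (X t)) t ∧
      HasDerivAt (fun t => 2 / apxTimeDeriv q r (X t))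
        (-(4 * apxTimeDeriv₂ q r (X t) / apxTimeDeriv q r (X t) ^ 3)) t := by
  obtain ⟨x₀, hx₀⟩ := eventually_atTop.1 ((eventually_apxTimeDeriv_pos hq hr hrq).and
    (eventually_gt_atTop 0))
  have hx0 : 0 < x₀ := (hx₀ x₀ le_rfl).2
  have hcont : ContinuousOn (apxTime q r) (Set.Ici x₀) := fun x hx =>
    (hasDerivAt_apxTime (hx0.trans_le hx)).continuousAt.continuousWithinAt
  have hmono : StrictMonoOn (apxTime q r) (Set.Ici x₀) := by
    refine strictMonoOn_of_deriv_pos (convex_Ici _) hcont fun x hx => ?_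
    rw [interior_Ici] at hx
    rw [(hasDerivAt_apxTime (hx0.trans hx)).deriv]
    exact (hx₀ x (le_of_lt hx)).1
  have hex : ∀ t, ∃ x, apxTime q r x₀ ≤ 2 * t → x₀ ≤ x ∧ apxTime q r x = 2 * t := by
    intro t
    by_cases ht : apxTime q r x₀ ≤ 2 * t
    · obtain ⟨b, hb1, hb2⟩ := ((tendsto_apxTime_atTop hr hrq).eventually_ge_atTop (2 * t)).and
        (eventually_ge_atTop x₀) |>.exists
      obtain ⟨x, hx, hxe⟩ := intermediate_value_Icc hb2 (hcont.mono Set.Icc_subset_Ici_self)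
        ⟨ht, hb1⟩
      exact ⟨x, fun _ => ⟨hx.1, hxe⟩⟩
    · exact ⟨0, fun h => absurd h ht⟩
  choose X hX using hex
  set t₀ := max (apxTime q r x₀ / 2) 1 with ht₀
  have hle : ∀ t, t₀ < t → apxTime q r x₀ < 2 * t := by
    intro t ht
    have := (le_max_left _ _).trans_lt ht
    linarith
  have hXgt : ∀ t, t₀ < t → x₀ < X t := by
    intro t ht
    obtain ⟨h1, h2⟩ := hX t (hle t ht).le
    refine lt_of_le_of_ne h1 fun h => ?_
    rw [← h] at h2
    exact (hle t ht).ne h2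
  have hXmono : MonotoneOn X (Set.Ioi t₀) := by
    intro s hs t ht hst
    obtain ⟨h1, h2⟩ := hX s (hle s hs).le
    obtain ⟨h3, h4⟩ := hX t (hle t ht).le
    refine (hmono.le_iff_le h1 h3).1 ?_
    rw [h2, h4]; linarith
  have hright : ∀ x, x₀ < x → X (apxTime q r x / 2) = x := by
    intro x hx
    have := hmono (Set.self_mem_Ici) (Set.mem_Ici.2 hx.le) hx
    obtain ⟨h1, h2⟩ := hX (apxTime q r x / 2) (by linarith)
    refine hmono.injOn h1 (Set.mem_Ici.2 hx.le) ?_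
    rw [h2]; ring
  have hXcont : ∀ t, t₀ < t → ContinuousAt X t := by
    intro t ht
    refine continuousAt_of_monotoneOn_of_image_mem_nhds hXmono (Ioi_mem_nhds ht) ?_
    have h0 := hXgt t ht
    have h2 := (hX t (hle t ht).le).2
    have hev : ∀ᶠ x in 𝓝 (X t), 2 * t₀ < apxTime q r x := by
      refine (hasDerivAt_apxTime (hx0.trans h0)).continuousAt.eventually (lt_mem_nhds ?_)
      rw [h2]; linarith
    filter_upwards [hev, Ioi_mem_nhds h0] with x h3 h4
    exact ⟨apxTime q r x / 2, by simp only [Set.mem_Ioi]; linarith, hright x h4⟩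
  refine ⟨t₀, lt_of_lt_of_le one_pos (le_max_right _ _), X, ?_, fun t ht => ?_⟩
  · refine tendsto_atTop.2 fun M => ?_
    filter_upwards [eventually_gt_atTop t₀,
      eventually_ge_atTop (apxTime q r (max M x₀) / 2)] with t ht htM
    obtain ⟨h1, h2⟩ := hX t (hle t ht).le
    refine (le_max_left M x₀).trans ((hmono.le_iff_le (Set.mem_Ici.2 (le_max_right _ _)) h1).1 ?_)
    rw [h2]; linarith
  · have h0 := hXgt t ht
    have hpos : 0 < X t := hx0.trans h0
    have hd : apxTimeDeriv q r (X t) ≠ 0 := (hx₀ _ h0.le).1.ne'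
    have hXd : HasDerivAt X (2 / apxTimeDeriv q r (X t)) t := by
      have := HasDerivAt.of_local_left_inverse (f := fun x => apxTime q r x / 2) (hXcont t ht)
        ((hasDerivAt_apxTime hpos).div_const 2) (div_ne_zero hd two_ne_zero) (by
          filter_upwards [Ioi_mem_nhds ht] with s hs
          rw [(hX s (hle s hs).le).2]; ring)
      rwa [inv_div] at this
    refine ⟨hpos, hd, (hX t (hle t ht).le).2, hXd, ?_⟩
    have h3 := ((hasDerivAt_apxTimeDeriv (q := q) (r := r) hpos).comp t hXd)
    refine (((hasDerivAt_const t (2 : ℝ)).div h3 hd)).congr_deriv ?_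
    simp only [Function.comp]
    field_simp
    ring

/-- Since T(X) ~ X^q and T(X) = 2t, powers of X translate into powers of t. -/
theorem isTheta_apxSolution_rpow (hr : 0 < r) (hrq : r < q / 2) {X : ℝ → ℝ}
    (hX : Tendsto X atTop atTop) (hXt : ∀ᶠ t in atTop, apxTime q r (X t) = 2 * t) (p : ℝ) :
    (fun t => X t ^ p) =Θ[atTop] (fun t : ℝ => t ^ (p / q)) := by
  have hq0 : q ≠ 0 := by linarith
  have hz := tendsto_rpow_zero_of_neg (show r - q < 0 by linarith) hX
  have h := tendsto_one_of_isBigO hz (isBigO_rpow_sub_one (-(p / q)) hz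
    (apxTime_div_sub_one hr hrq hX))
  have he : (fun t => X t ^ p) ~[atTop] (fun t : ℝ => (2 * t) ^ (p / q)) := by
    refine (isEquivalent_iff_tendsto_one ?_).2 (h.congr' ?_)
    · filter_upwards [eventually_gt_atTop 0] with t ht
      positivity
    · filter_upwards [eventually_gt_atTop 0, hXt, hX.eventually_gt_atTop 0] with t ht h1 h2
      simp only [Pi.div_apply]
      rw [h1, Real.div_rpow (by positivity) (by positivity), ← Real.rpow_mul h2.le,
        Real.rpow_neg (by positivity), show q * -(p / q) = -p by field_simp, Real.rpow_neg h2.le,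
        inv_div_inv]
  refine he.isTheta.trans ?_
  have : (fun t : ℝ => (2 * t) ^ (p / q)) =ᶠ[atTop] fun t => (2 : ℝ) ^ (p / q) * t ^ (p / q) := by
    filter_upwards [eventually_gt_atTop 0] with t ht
    exact Real.mul_rpow two_pos.le ht.le
  refine this.trans_isTheta ?_
  exact (isTheta_refl _ _).const_mul_left (Real.rpow_pos_of_pos two_pos _).ne'

end InverseFunction

/-! ### Solving the Emden-Fowler equation near the approximate solution. -/

section Existence

variable {q r : ℝ}

theorem abs_clamp_sub_clamp_le (c x y : ℝ) :
    |max (-c) (min c x) - max (-c) (min c y)| ≤ |x - y| := by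
  have h1 := abs_max_sub_max_le_abs (min c x) (min c y) (-c)
  rw [max_comm _ (-c), max_comm _ (-c)] at h1
  have h2 := abs_min_sub_min_le_max c x c y
  rw [sub_self, abs_zero, max_eq_right (abs_nonneg _)] at h2
  exact h1.trans h2

theorem abs_clamp_le {c : ℝ} (hc : 0 ≤ c) (x : ℝ) : |max (-c) (min c x)| ≤ c :=
  abs_le.2 ⟨le_max_left _ _, max_le (by linarith) (min_le_left _ _)⟩

theorem clamp_eq_self {c x : ℝ} (hx : |x| ≤ c) : max (-c) (min c x) = x := by
  rw [min_eq_right (abs_le.1 hx).2, max_eq_right (abs_le.1 hx).1]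

/-- Uniform control of the linearization in a shrinking neighbourhood of the approximate
solution. -/
theorem eventually_linearization_bound (hq : 1 < q) (hr : 0 < r) (hrq : r < q / 2) {X : ℝ → ℝ}
    (hX : Tendsto X atTop atTop) (hXt : ∀ᶠ t in atTop, apxTime q r (X t) = 2 * t) :
    ∃ B : ℝ, ∀ᶠ t in atTop, ∀ y : ℝ, |y| ≤ t ^ (r / q - 2 + 1 / q) → 0 < X t + y ∧
      |(q * (X t + y) ^ (q - 1) + r * (X t + y) ^ (r - 1))
        * Real.exp ((X t + y) ^ q + (X t + y) ^ r - 2 * t) - q * leadConst q / 2 / t|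
        ≤ B * t ^ (r / q - 2) := by
  have hq0 : q ≠ 0 := by linarith
  -- A filter on pairs (t, y) with t → ∞ and y in the shrinking window: an O-statement along it is a
  -- bound uniform in y.
  set l : Filter (ℝ × ℝ) :=
    comap Prod.fst atTop ⊓ 𝓟 {p : ℝ × ℝ | |p.2| ≤ p.1 ^ (r / q - 2 + 1 / q)} with hl
  have hfst : Tendsto (Prod.fst : ℝ × ℝ → ℝ) l atTop := tendsto_comap.mono_left inf_le_left
  have hXl : Tendsto (fun p : ℝ × ℝ => X p.1) l atTop := hX.comp hfst
  have hV : (fun p : ℝ × ℝ => (X p.1 + p.2) - X p.1) =O[l] (fun p => X p.1 ^ (r - 2 * q + 1)) := by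
    have h1 : (fun p : ℝ × ℝ => (X p.1 + p.2) - X p.1) =O[l]
        (fun p => p.1 ^ (r / q - 2 + 1 / q)) := by
      refine IsBigO.of_bound 1 ?_
      have : ∀ᶠ p in l, |p.2| ≤ p.1 ^ (r / q - 2 + 1 / q) :=
        mem_inf_of_right (mem_principal_self _)
      filter_upwards [this, hfst.eventually_gt_atTop 0] with p hp hp0
      rw [add_sub_cancel_left, one_mul, Real.norm_eq_abs, Real.norm_of_nonneg (by positivity)]
      exact hp
    refine h1.trans ?_
    have h2 := (isTheta_apxSolution_rpow hr hrq hX hXt (r - 2 * q + 1)).2.comp_tendsto hfst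
    refine h2.congr_left fun p => ?_
    simp only [Function.comp]
    congr 1
    field_simp
  have hlin := (linearization_sub hq hr hrq hXl hV).trans
    ((isTheta_apxSolution_rpow hr hrq hX hXt (r - 2 * q)).1.comp_tendsto hfst)
  obtain ⟨B, hB⟩ := hlin.bound
  have hpos := eventually_pos_of_near (by linarith) hXl hV
  have hXt' : ∀ᶠ p in l, apxTime q r (X p.1) = 2 * p.1 := hfst.eventually hXt
  have hall := (hB.and hpos).and (hXt'.and (hfst.eventually_gt_atTop 0))
  rw [hl, eventually_inf_principal, eventually_comap] at hall
  refine ⟨B, hall.mono fun t ht y hy => ?_⟩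
  obtain ⟨⟨h1, h2⟩, h3, h4⟩ := ht (t, y) rfl hy
  simp only [Function.comp] at h1 h2 h3 h4
  refine ⟨h2, ?_⟩
  rw [h3, Real.norm_eq_abs, Real.norm_of_nonneg (by positivity)] at h1
  have e1 : (r - 2 * q) / q = r / q - 2 := by field_simp
  have e2 : q * leadConst q / (2 * t) = q * leadConst q / 2 / t := by field_simp
  rwa [e1, e2] at h1

/-- A solution of the Emden-Fowler form of the equation close to the approximate solution. -/
theorem exists_emden_solution (hq : 1 < q) (hr : 0 < r) (hrq : r < q / 2) :
    ∃ t₁ : ℝ, ∃ X v v' : ℝ → ℝ, Tendsto X atTop atTop ∧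
      (∀ᶠ t in atTop, apxTime q r (X t) = 2 * t) ∧
      (fun t => v t - X t) =O[atTop] (fun t => X t ^ (r - 2 * q + 1)) ∧
      ∀ t, t₁ < t → 0 < v t ∧ HasDerivAt v (v' t) t ∧
        HasDerivAt v' (-Real.exp (v t ^ q + v t ^ r - 2 * t)) t := by
  have hq0 : 0 < q := by linarith
  obtain ⟨t₀, ht₀, X, hX, hXp⟩ := exists_apxSolution hq hr hrq
  have hXt : ∀ᶠ t in atTop, apxTime q r (X t) = 2 * t := by
    filter_upwards [eventually_gt_atTop t₀] with t ht using (hXp t ht).2.2.1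
  obtain ⟨B₁, hB₁⟩ := eventually_linearization_bound hq hr hrq hX hXt
  set e : ℝ := r / q - 2 + 1 / q with he
  set ε : ℝ := 1 / 2 - r / q with hεdef
  have ha : r / q < 1 / 2 := by rw [div_lt_iff₀ hq0]; linarith
  have ha0 : 0 < r / q := by positivity
  have hq1 : 1 / q < 1 := by rw [div_lt_one hq0]; exact hq
  have hε : 0 < ε := by rw [hεdef]; linarith
  set κ : ℝ := q * leadConst q / 2 with hκdef
  have hκ : 0 < κ := by have := leadConst_pos hq; positivity
  set D : ℝ → ℝ := fun t => 4 * apxTimeDeriv₂ q r (X t) / apxTimeDeriv q r (X t) ^ 3 with hD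
  set E : ℝ → ℝ → ℝ := fun t y => Real.exp ((X t + y) ^ q + (X t + y) ^ r - 2 * t) with hE
  -- The forcing left once the oscillator potential is split off. Its value at y = 0 is the residual
  -- of X, and its y-derivative is the linearization error plus 3/(16t²). The latter is absorbed by
  -- the 1 in B₁ + 1.
  set N : ℝ → ℝ → ℝ := fun t y => D t - E t y + (κ / t + 3 / 16 / t ^ 2) * y with hN
  obtain ⟨B₂, hB₂⟩ := ((apxTime_residual hq hr hrq hX).trans
    (isTheta_apxSolution_rpow hr hrq hX hXt (1 + 2 * r - 4 * q)).1).bound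
  obtain ⟨t₁, ht₁⟩ := eventually_atTop.1 ((hB₁.and hB₂).and
    ((eventually_gt_atTop t₀).and (eventually_ge_atTop 1)))
  have ht₁0 : 0 < t₁ := ht₀.trans (ht₁ t₁ le_rfl).2.1
  have hN0 : ∀ t, t₁ ≤ t → |N t 0| ≤ B₂ * t ^ (e - 3 / 2 - ε) := by
    intro t ht
    obtain ⟨⟨-, h1⟩, h2, h3⟩ := ht₁ t ht
    have ht0 : 0 < t := by linarith
    rw [(hXp t h2).2.2.1, Real.norm_eq_abs, Real.norm_of_nonneg (by positivity), abs_sub_comm] at h1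
    have e1 : (1 + 2 * r - 4 * q) / q = e - 3 / 2 - ε := by
      rw [he, hεdef]; field_simp; ring
    rw [e1] at h1
    simpa [hN, hE, hD] using h1
  have hlip : ∀ t, t₁ ≤ t → ∀ x y, |x| ≤ t ^ e → |y| ≤ t ^ e →
      |N t x - N t y| ≤ (B₁ + 1) * t ^ (-(3 / 2) - ε) * |x - y| := by
    intro t ht x y hx hy
    obtain ⟨⟨h1, -⟩, h2, h3⟩ := ht₁ t ht
    have ht0 : 0 < t := by linarith
    have hconv : Convex ℝ (Set.Icc (-t ^ e) (t ^ e)) := convex_Icc _ _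
    refine hconv.norm_image_sub_le_of_norm_hasDerivWithin_le (f := N t)
      (f' := fun y => -(E t y * (q * (X t + y) ^ (q - 1) + r * (X t + y) ^ (r - 1)))
        + (κ / t + 3 / 16 / t ^ 2)) ?_ ?_ (abs_le.1 hy) (abs_le.1 hx)
    · intro z hz
      have hp := (h1 z (abs_le.2 hz)).1
      have hz1 : HasDerivAt (fun y => X t + y) 1 z := (hasDerivAt_id z).const_add _
      have hg := (((hz1.rpow_const (p := q) (Or.inl hp.ne')).add
        (hz1.rpow_const (p := r) (Or.inl hp.ne'))).sub_const (2 * t)).exp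
      refine HasDerivAt.hasDerivWithinAt ((((hg.const_sub (D t)).add
        ((hasDerivAt_id z).const_mul (κ / t + 3 / 16 / t ^ 2)))).congr_deriv ?_)
      simp only [hE, Pi.add_apply]
      ring
    · intro z hz
      have hb := (h1 z (abs_le.2 hz)).2
      have e1 : -(3 / 2) - ε = r / q - 2 := by rw [hεdef]; ring
      rw [e1, Real.norm_eq_abs]
      have hsq : 3 / 16 / t ^ 2 ≤ t ^ (r / q - 2) := by
        have h4 : t ^ (-2 : ℝ) ≤ t ^ (r / q - 2) :=
          Real.rpow_le_rpow_of_exponent_le h3 (by linarith)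
        have h5 : t ^ (-2 : ℝ) = 1 / t ^ 2 := by
          rw [Real.rpow_neg ht0.le, one_div]; norm_cast
        have h6 : 3 / 16 / t ^ 2 ≤ 1 / t ^ 2 := by gcongr; norm_num
        linarith
      have h7 : 0 < 3 / 16 / t ^ 2 := by positivity
      rw [mul_comm] at hb
      change |E t z * _ - κ / t| ≤ _ at hb
      rw [abs_le] at hb ⊢
      constructor <;> linarith [hb.1, hb.2]
  have hB₁0 : 0 ≤ B₁ + 1 := by
    have h0 : |(0:ℝ)| ≤ t₁ ^ e := by rw [abs_zero]; positivity
    have h1 : |t₁ ^ e| ≤ t₁ ^ e := (abs_of_pos (Real.rpow_pos_of_pos ht₁0 e)).le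
    have h2 := (abs_nonneg _).trans (hlip t₁ le_rfl (t₁ ^ e) 0 h1 h0)
    rw [sub_zero] at h2
    have h3 : 0 < |t₁ ^ e| := by positivity
    have h4 : 0 < t₁ ^ (-(3 / 2) - ε) := by positivity
    exact nonneg_of_mul_nonneg_left (nonneg_of_mul_nonneg_left h2 h3) h4
  -- Clamping y to |y| ≤ t^e, and t to t ≥ t₁, makes the forcing globally defined, continuous,
  -- bounded and Lipschitz. The solution found satisfies |φ| ≤ t^e, so the clamp is inactive on it.
  set H : ℝ → ℝ → ℝ := fun t y => N (max t t₁)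
    (max (-(max t t₁) ^ e) (min ((max t t₁) ^ e) y)) with hH
  have hHeq : ∀ t, t₁ ≤ t → ∀ y, H t y = N t (max (-t ^ e) (min (t ^ e) y)) := by
    intro t ht y
    simp only [hH, max_eq_left ht]
  have hHc : Continuous (Function.uncurry H) := by
    have hcs : Continuous fun p : ℝ × ℝ => max p.1 t₁ := continuous_fst.max continuous_const
    have hs0 : ∀ p : ℝ × ℝ, 0 < max p.1 t₁ := fun p => ht₁0.trans_le (le_max_right _ _)
    have hst : ∀ p : ℝ × ℝ, t₀ < max p.1 t₁ := fun p => (ht₁ _ (le_max_right _ _)).2.1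
    have hce : Continuous fun p : ℝ × ℝ => (max p.1 t₁) ^ e :=
      hcs.rpow_const fun p => Or.inl (hs0 p).ne'
    have hcy : Continuous fun p : ℝ × ℝ =>
        max (-(max p.1 t₁) ^ e) (min ((max p.1 t₁) ^ e) p.2) :=
      hce.neg.max (hce.min continuous_snd)
    have hcX : Continuous fun p : ℝ × ℝ => X (max p.1 t₁) := continuous_iff_continuousAt.2 fun p =>
      ContinuousAt.comp (f := fun p : ℝ × ℝ => max p.1 t₁)
        (hXp _ (hst p)).2.2.2.1.continuousAt hcs.continuousAt
    have hcD : Continuous fun p : ℝ × ℝ => D (max p.1 t₁) := by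
      refine continuous_iff_continuousAt.2 fun p => ?_
      have hp := (hXp _ (hst p)).1
      have hne := (hXp _ (hst p)).2.1
      have c1 : ContinuousAt (fun p : ℝ × ℝ => apxTimeDeriv q r (X (max p.1 t₁))) p :=
        ContinuousAt.comp (f := fun p : ℝ × ℝ => X (max p.1 t₁))
          (hasDerivAt_apxTimeDeriv hp).continuousAt hcX.continuousAt
      have c2 : ContinuousAt (apxTimeDeriv₂ q r) (X (max p.1 t₁)) := by
        have hr' := fun p' : ℝ => Real.continuousAt_rpow_const (X (max p.1 t₁)) p' (Or.inl hp.ne')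
        unfold apxTimeDeriv₂
        have := hp.ne'
        have := hr' (q - 1 - 1)
        have := hr' (r - 1 - 1)
        have := hr' (r - q - 1 - 1)
        have := hr' (-q - 1 - 1)
        fun_prop (disch := positivity)
      exact ((ContinuousAt.comp (f := fun p : ℝ × ℝ => X (max p.1 t₁)) c2
        hcX.continuousAt).const_mul 4).div (c1.pow 3) (pow_ne_zero 3 hne)
    have hcv := hcX.add hcy
    have hcE : Continuous fun p : ℝ × ℝ => E (max p.1 t₁)
        (max (-(max p.1 t₁) ^ e) (min ((max p.1 t₁) ^ e) p.2)) := by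
      refine Real.continuous_exp.comp (((hcv.rpow_const fun p => Or.inr hq0.le).add
        (hcv.rpow_const fun p => Or.inr hr.le)).sub (hcs.const_mul 2))
    exact (hcD.sub hcE).add (((continuous_const.div hcs fun p => (hs0 p).ne').add
      (continuous_const.div (hcs.pow 2) fun p => (pow_pos (hs0 p) 2).ne')).mul hcy)
  obtain ⟨t₂, ht₂, φ, φ', hφ⟩ := exists_solution_near_oscillator (κ := κ) (H := H) (t₀ := t₁)
    (B := |B₂| + (B₁ + 1)) (e := e) (ε := ε) hκ ht₁0 hε (by rw [he]; linarith) hHc (by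
      intro t ht y
      have ht0 : 0 < t := ht₁0.trans_le ht
      rw [hHeq t ht]
      set c := max (-t ^ e) (min (t ^ e) y)
      have hc : |c| ≤ t ^ e := abs_clamp_le (by positivity) y
      have h1 := hlip t ht c 0 hc (by rw [abs_zero]; positivity)
      have h2 := hN0 t ht
      have h3 : |N t c| ≤ |N t 0| + |N t c - N t 0| := by
        have := abs_add_le (N t 0) (N t c - N t 0)
        rwa [add_sub_cancel] at this
      rw [sub_zero] at h1
      have e1 : t ^ (e - 3 / 2 - ε) = t ^ (-(3 / 2) - ε) * t ^ e := by
        rw [← Real.rpow_add ht0]; congr 1; ring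
      have h4 : (B₁ + 1) * t ^ (-(3 / 2) - ε) * |c| ≤ (B₁ + 1) * t ^ (e - 3 / 2 - ε) := by
        rw [e1, ← mul_assoc]; gcongr
      have h5 : B₂ * t ^ (e - 3 / 2 - ε) ≤ |B₂| * t ^ (e - 3 / 2 - ε) := by
        gcongr; exact le_abs_self _
      linarith) (by
      intro t ht x y
      have ht0 : 0 < t := ht₁0.trans_le ht
      rw [hHeq t ht, hHeq t ht]
      refine (hlip t ht _ _ (abs_clamp_le (by positivity) x) (abs_clamp_le (by positivity) y)).trans ?_
      have := abs_clamp_sub_clamp_le (t ^ e) x y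
      have hB : B₁ + 1 ≤ |B₂| + (B₁ + 1) := by linarith [abs_nonneg B₂]
      gcongr)
  refine ⟨t₂, X, fun t => X t + φ t, fun t => 2 / apxTimeDeriv q r (X t) + φ' t, hX, hXt, ?_, ?_⟩
  · have h1 : (fun t => X t + φ t - X t) =O[atTop] (fun t : ℝ => t ^ e) := by
      refine IsBigO.of_bound 1 ?_
      filter_upwards [eventually_gt_atTop t₂, eventually_gt_atTop 0] with t ht ht0
      rw [add_sub_cancel_left, one_mul, Real.norm_eq_abs, Real.norm_of_nonneg (by positivity)]
      exact (hφ t ht).1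
    have h2 := (isTheta_apxSolution_rpow hr hrq hX hXt (r - 2 * q + 1)).2
    have e1 : (r - 2 * q + 1) / q = e := by rw [he]; field_simp
    rw [e1] at h2
    exact h1.trans h2
  · intro t ht
    have h1 : t₁ ≤ t := ht₂.trans ht.le
    obtain ⟨a1, a2, a3⟩ := hφ t ht
    obtain ⟨b1, b2, b3, b4, b5⟩ := hXp t (ht₁ t h1).2.1
    refine ⟨((ht₁ t h1).1.1 _ a1).1, b4.add a2, (b5.add a3).congr_deriv ?_⟩
    rw [hHeq t h1, clamp_eq_self a1]
    simp only [hN, hE, hD]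
    ring

end Existence

/-! ### Radial functions in the plane: Laplacian and smoothness. -/

section Radial

theorem hasDerivAt_comp_neg_half_log {v v' : ℝ → ℝ} {s : ℝ} (hs : 0 < s)
    (hv : HasDerivAt v (v' (-(1 / 2) * Real.log s)) (-(1 / 2) * Real.log s)) :
    HasDerivAt (fun s => v (-(1 / 2) * Real.log s))
      (-(1 / 2) * (v' (-(1 / 2) * Real.log s) / s)) s := by
  refine (hv.comp s ((Real.hasDerivAt_log hs.ne').const_mul (-(1 / 2)))).congr_deriv ?_
  field_simp

theorem neg_half_log_norm_sq (x : Plane) : -(1 / 2) * Real.log (‖x‖ ^ 2) = -Real.log ‖x‖ := by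
  rw [Real.log_pow]; push_cast; ring

/-- The Laplacian of `x ↦ v (-log ‖x‖)` in the plane. -/
theorem laplacian_comp_neg_log_norm {v v' v'' : ℝ → ℝ} {t₁ : ℝ}
    (hv : ∀ t, t₁ < t → HasDerivAt v (v' t) t) (hv' : ∀ t, t₁ < t → HasDerivAt v' (v'' t) t)
    {x : Plane} (hx : x ≠ 0) (hxt : t₁ < -Real.log ‖x‖) :
    Laplacian.laplacian (fun y : Plane => v (-Real.log ‖y‖)) x
      = v'' (-Real.log ‖x‖) / ‖x‖ ^ 2 := by
  set U : Set Plane := {y | y ≠ 0 ∧ t₁ < -Real.log ‖y‖} with hU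
  have hUo : IsOpen U := by
    have : U = {0}ᶜ ∩ (fun y : Plane => -Real.log ‖y‖) ⁻¹' Set.Ioi t₁ := by
      ext y; simp [hU]
    rw [this]
    refine ContinuousOn.isOpen_inter_preimage ?_ isOpen_compl_singleton isOpen_Ioi
    exact (ContinuousOn.log continuous_norm.continuousOn
      fun y hy => norm_ne_zero_iff.2 hy).neg
  set ψ : ℝ → ℝ := fun s => -(1 / 2) * (v' (-(1 / 2) * Real.log s) / s) with hψ
  -- With ‖y‖² as radial variable the inner derivative is linear in y, so the second differentiation
  -- is a plain product rule.
  have hsq : ∀ y : Plane, HasFDerivAt (fun y : Plane => ‖y‖ ^ 2) (2 • innerSL ℝ y) y :=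
    fun y => (hasStrictFDerivAt_norm_sq y).hasFDerivAt
  have hd1 : ∀ y ∈ U, HasFDerivAt (fun y : Plane => v (-Real.log ‖y‖))
      (ψ (‖y‖ ^ 2) • (2 • innerSL ℝ y)) y := by
    intro y hy
    have hpos : 0 < ‖y‖ ^ 2 := by have := norm_pos_iff.2 hy.1; positivity
    have h := (hasDerivAt_comp_neg_half_log (v := v) (v' := v') hpos (hv _ (by
      rw [neg_half_log_norm_sq]; exact hy.2))).comp_hasFDerivAt y (hsq y)
    refine h.congr_of_eventuallyEq (Eventually.of_forall fun z => ?_)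
    simp only [Function.comp, neg_half_log_norm_sq]
  have hpos : 0 < ‖x‖ ^ 2 := by have := norm_pos_iff.2 hx; positivity
  set ψ' : ℝ := -(1 / 2) * ((-(1 / 2) * (v'' (-Real.log ‖x‖) / ‖x‖ ^ 2) * ‖x‖ ^ 2
    - v' (-Real.log ‖x‖) * 1) / (‖x‖ ^ 2) ^ 2) with hψ'
  have hdψ : HasDerivAt ψ ψ' (‖x‖ ^ 2) := by
    have h1 := hasDerivAt_comp_neg_half_log (v := v') (v' := v'') hpos (hv' _ (by
      rw [neg_half_log_norm_sq]; exact hxt))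
    have h2 := (h1.div (hasDerivAt_id _) hpos.ne').const_mul (-(1 / 2))
    refine h2.congr_deriv ?_
    simp only [id, neg_half_log_norm_sq, hψ']
  have hxU : x ∈ U := ⟨hx, hxt⟩
  have hev : fderiv ℝ (fun y : Plane => v (-Real.log ‖y‖)) =ᶠ[𝓝 x]
      fun y => ψ (‖y‖ ^ 2) • (2 • innerSL ℝ y) := by
    filter_upwards [hUo.mem_nhds hxU] with y hy
    exact (hd1 y hy).fderiv
  have hd2 : HasFDerivAt (fun y : Plane => ψ (‖y‖ ^ 2) • (2 • innerSL ℝ y))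
      (ψ (‖x‖ ^ 2) • (2 • innerSL ℝ) + (ψ' • (2 • innerSL ℝ x)).smulRight (2 • innerSL ℝ x)) x := by
    have h1 := hdψ.comp_hasFDerivAt x (hsq x)
    exact h1.smul ((2 • innerSL ℝ : Plane →L[ℝ] Plane →L[ℝ] ℝ).hasFDerivAt)
  rw [InnerProductSpace.laplacian_eq_iteratedFDeriv_orthonormalBasis _
    (EuclideanSpace.basisFun (Fin 2) ℝ)]
  simp only [iteratedFDeriv_two_apply, hev.fderiv_eq, hd2.fderiv]
  have hi : ∀ i : Fin 2, (innerSL ℝ : Plane →L[ℝ] Plane →L[ℝ] ℝ) (EuclideanSpace.single i 1)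
      (EuclideanSpace.single i 1) = 1 := by
    intro i
    change inner ℝ (EuclideanSpace.single i (1 : ℝ)) (EuclideanSpace.single i (1 : ℝ)) = 1
    simp
  have hn : ‖x‖ ^ 2 = x 0 ^ 2 + x 1 ^ 2 := by
    rw [EuclideanSpace.norm_sq_eq]; simp
  simp [Fin.sum_univ_two, EuclideanSpace.inner_single_right]
  rw [hi 0, hi 1]
  simp only [hψ, neg_half_log_norm_sq, hψ']
  generalize v'' (-Real.log ‖x‖) = a
  generalize v' (-Real.log ‖x‖) = b
  rw [hn] at hpos ⊢
  field_simp
  ring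

/-- A solution of `v'' = Φ(t, v)` with smooth right-hand side is smooth. -/
theorem contDiffOn_of_second_order {v v' : ℝ → ℝ} {Φ : ℝ → ℝ → ℝ} {t₁ : ℝ} {S : Set (ℝ × ℝ)}
    (hv : ∀ t, t₁ < t → HasDerivAt v (v' t) t)
    (hv' : ∀ t, t₁ < t → HasDerivAt v' (Φ t (v t)) t) (hS : ∀ t, t₁ < t → (t, v t) ∈ S)
    (hΦ : ContDiffOn ℝ ∞ (Function.uncurry Φ) S) : ContDiffOn ℝ ∞ v (Set.Ioi t₁) := by
  have step : ∀ n : ℕ, ContDiffOn ℝ n v (Set.Ioi t₁) ∧ ContDiffOn ℝ n v' (Set.Ioi t₁) := by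
    intro n
    induction n with
    | zero =>
      simp only [Nat.cast_zero, contDiffOn_zero]
      exact ⟨fun t ht => (hv t ht).continuousAt.continuousWithinAt,
        fun t ht => (hv' t ht).continuousAt.continuousWithinAt⟩
    | succ n ih =>
      have hn : ((n + 1 : ℕ) : WithTop ℕ∞) = (n : WithTop ℕ∞) + 1 := by push_cast; rfl
      rw [hn, contDiffOn_succ_iff_deriv_of_isOpen isOpen_Ioi,
        contDiffOn_succ_iff_deriv_of_isOpen isOpen_Ioi]
      refine ⟨⟨fun t ht => (hv t ht).differentiableAt.differentiableWithinAt, by simp, ?_⟩,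
        ⟨fun t ht => (hv' t ht).differentiableAt.differentiableWithinAt, by simp, ?_⟩⟩
      · exact ih.2.congr fun t ht => (hv t ht).deriv
      · have hc : ContDiffOn ℝ n (fun t => Function.uncurry Φ (t, v t)) (Set.Ioi t₁) :=
          (hΦ.of_le (by exact_mod_cast le_top)).comp (contDiffOn_id.prodMk ih.1) fun t ht => hS t ht
        exact hc.congr fun t ht => (hv' t ht).deriv
  exact contDiffOn_infty.2 fun n => (step n).1

end Radial

/-! ### From the implicit relation to the explicit expansion. -/

section Expansion

variable {q r : ℝ} {α : Type*} {l : Filter α} {X V L s : α → ℝ}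

theorem isTheta_rpow_of_near {c : ℝ} (p : ℝ) (hc : c < 1) (hX : Tendsto X l atTop)
    (hV : (fun i => V i - X i) =O[l] (fun i => X i ^ c)) :
    (fun i => V i ^ p) =Θ[l] (fun i => X i ^ p) := by
  have h := tendsto_one_of_isBigO (tendsto_rpow_zero_of_neg (by linarith) hX)
    (isBigO_rpow_div_sub_one p hc hX hV)
  refine IsEquivalent.isTheta ((isEquivalent_iff_tendsto_one ?_).2 (h.congr' ?_))
  · filter_upwards [hX.eventually_gt_atTop 0] with i hi
    positivity
  · filter_upwards [hX.eventually_gt_atTop 0, eventually_pos_of_near hc hX hV] with i hi hv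
    exact Real.div_rpow hv.le hi.le p

theorem tendsto_atTop_of_near {c : ℝ} (hc : c < 1) (hX : Tendsto X l atTop)
    (hV : (fun i => V i - X i) =O[l] (fun i => X i ^ c)) : Tendsto V l atTop := by
  have h := tendsto_one_of_isBigO (tendsto_rpow_zero_of_neg (by linarith) hX)
    (isBigO_rpow_div_sub_one 1 hc hX hV)
  simp only [Real.rpow_one] at h
  refine (h.pos_mul_atTop zero_lt_one hX).congr' ?_
  filter_upwards [hX.eventually_gt_atTop 0] with i hi
  field_simp

/-- Inversion of `s + s ^ (r / q) ≈ L - (q - 1) / q * log L - log q`. -/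
theorem rpow_sub_expansion (hq : 1 < q) (hr : 0 < r) (hrq : r < q / 2) (hL : Tendsto L l atTop)
    (hs : (fun i => s i - L i) =O[l] (fun i => L i ^ (r / q)))
    (h : (fun i => s i + s i ^ (r / q) - (L i - (q - 1) / q * Real.log (L i) - Real.log q))
      =O[l] (fun i => L i ^ (r / q - 1))) :
    (fun i => s i ^ (1 / q) - expansion q r 2 (L i))
      =O[l] (fun i => L i ^ (-(2 - 1 / q - r / q))) := by
  have hq0 : 0 < q := by linarith
  set a : ℝ := r / q with hadef
  set b : ℝ := (q - 1) / q with hb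
  have ha : a < 1 / 2 := by rw [hadef, div_lt_iff₀ hq0]; linarith
  have ha0 : 0 < a := by positivity
  have hlog : (fun i => Real.log (L i)) =O[l] (fun i => L i ^ a) := isBigO_log_rpow ha0 hL
  set σ : α → ℝ := fun i => L i - L i ^ a - b * Real.log (L i) with hσ
  have hσL : (fun i => σ i - L i) =O[l] (fun i => L i ^ a) := by
    refine ((isBigO_refl (fun i => L i ^ a) l).neg_left.sub
      (hlog.const_mul_left b)).congr_left fun i => ?_
    simp only [hσ]; ring
  have hσtop := tendsto_atTop_of_near (by linarith) hL hσL
  -- The difference is O(L^(2a-1)), which is bounded since a < 1/2. So σ is already within O(1) of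
  -- s.
  have hsa : (fun i => s i ^ a - L i ^ a) =O[l] (fun i => L i ^ (0 : ℝ)) :=
    (isBigO_rpow_sub_rpow a (by linarith) hL hs).trans (isBigO_rpow_rpow (by linarith) hL)
  have hsσ : (fun i => s i - σ i) =O[l] (fun i => σ i ^ (0 : ℝ)) := by
    have h1 := ((h.trans (isBigO_rpow_rpow (p' := 0) (by linarith) hL)).sub hsa)
    simp only [Real.rpow_zero] at h1 ⊢
    refine (h1.sub (isBigO_const_const (Real.log q) one_ne_zero l)).congr_left fun i => ?_
    simp only [hσ]; ring
  have hsσa : (fun i => s i ^ a - σ i ^ a) =O[l] (fun i => L i ^ (a - 1)) := by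
    have h1 := isBigO_rpow_sub_rpow a (by norm_num) hσtop hsσ
    rw [add_zero] at h1
    exact h1.trans (isTheta_rpow_of_near (a - 1) (by linarith) hL hσL).1
  -- Y is the relation for s solved with σ^a in place of s^a, at a cost of only O(L^(a-1)). The last
  -- power 1/q multiplies this by L^(1/q-1).
  set Y : α → ℝ := fun i => L i - σ i ^ a - b * Real.log (L i) + Real.log (1 / q) with hY
  have hs_top := tendsto_atTop_of_near (by linarith) hL hs
  have hYs : (fun i => Y i - s i) =O[l] (fun i => s i ^ (a - 1)) := by
    refine ((hsσa.sub h).congr_left fun i => ?_).trans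
      (isTheta_rpow_of_near (a - 1) (by linarith) hL hs).2
    simp only [hY, one_div, Real.log_inv]; ring
  have h1 := (isBigO_rpow_sub_rpow (1 / q) (by linarith) hs_top hYs).trans
    (isTheta_rpow_of_near _ (by linarith) hL hs).1
  refine h1.neg_left.congr (fun i => ?_) (fun i => ?_)
  · simp only [neg_sub, expansion, hY, hσ]
    norm_num [hadef, hb]
  · congr 1; ring

/-- `-log w` as a function of `t = -log |x|`. -/
noncomputable def negLogW (q t : ℝ) : ℝ := 2 * t - Real.log (2 * t + 1) - Real.log (q / (q - 1) / 4)

theorem negLogW_sub {a : ℝ} (ha0 : 0 < a) (q : ℝ) :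
    (fun t => negLogW q t - 2 * t) =O[atTop] (fun t : ℝ => (2 * t) ^ a) := by
  have hT : Tendsto (fun t : ℝ => 2 * t) atTop atTop := tendsto_id.const_mul_atTop two_pos
  have h1 : (fun t : ℝ => Real.log (2 * t + 1)) =O[atTop] (fun t : ℝ => (2 * t) ^ a) := by
    refine (isBigO_log_rpow ha0 (hT.atTop_add tendsto_const_nhds)).trans ?_
    refine (isTheta_rpow_of_near (c := 0) a zero_lt_one hT ?_).1
    simp only [add_sub_cancel_left, Real.rpow_zero]
    exact isBigO_refl _ _
  have h0 := isBigO_rpow_rpow (X := fun t : ℝ => 2 * t) ha0.le hT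
  simp only [Real.rpow_zero] at h0
  refine (h1.neg_left.sub ((isBigO_const_const (Real.log (q / (q - 1) / 4)) one_ne_zero _).trans
    h0)).congr_left fun t => ?_
  unfold negLogW; ring

theorem isBigO_log_sub_log {c : ℝ} (hc : c < 1) (hX : Tendsto X l atTop)
    (hV : (fun i => V i - X i) =O[l] (fun i => X i ^ c)) :
    (fun i => Real.log (V i) - Real.log (X i)) =O[l] (fun i => X i ^ (c - 1)) := by
  have h := isBigO_rpow_div_sub_one 1 hc hX hV
  simp only [Real.rpow_one] at h
  refine (isBigO_log (tendsto_rpow_zero_of_neg (by linarith) hX) h).congr' ?_ EventuallyEq.rfl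
  filter_upwards [hX.eventually_gt_atTop 0, eventually_pos_of_near hc hX hV] with i hi hv
  exact Real.log_div hv.ne' hi.ne'

theorem emden_solution_expansion (hq : 1 < q) (hr : 0 < r) (hrq : r < q / 2) {X v : ℝ → ℝ}
    (hX : Tendsto X atTop atTop) (hXt : ∀ᶠ t in atTop, apxTime q r (X t) = 2 * t)
    (hv : (fun t => v t - X t) =O[atTop] (fun t => X t ^ (r - 2 * q + 1))) :
    (fun t => v t - expansion q r 2 (negLogW q t))
      =O[atTop] (fun t => negLogW q t ^ (-(2 - 1 / q - r / q))) := by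
  have hq0 : 0 < q := by linarith
  have hq1 : 0 < q - 1 := by linarith
  set a : ℝ := r / q with hadef
  have ha : a < 1 / 2 := by rw [hadef, div_lt_iff₀ hq0]; linarith
  have ha0 : 0 < a := by positivity
  have hT : Tendsto (fun t : ℝ => 2 * t) atTop atTop := tendsto_id.const_mul_atTop two_pos
  have hLT := negLogW_sub ha0 q
  have hL := tendsto_atTop_of_near (by linarith) hT hLT
  have hTL : ∀ p : ℝ, (fun t : ℝ => (2 * t) ^ p) =O[atTop] (fun t => negLogW q t ^ p) := fun p =>
    (isTheta_rpow_of_near p (by linarith) hT hLT).2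
  have htT : ∀ p : ℝ, (fun t : ℝ => t ^ p) =O[atTop] (fun t => (2 * t) ^ p) := by
    intro p
    refine IsBigO.of_bound ((2 : ℝ) ^ p)⁻¹ ?_
    filter_upwards [eventually_gt_atTop 0] with t ht
    rw [Real.norm_of_nonneg (by positivity), Real.norm_of_nonneg (by positivity),
      Real.mul_rpow two_pos.le ht.le]
    have : 0 < (2 : ℝ) ^ p := by positivity
    field_simp
    exact le_rfl
  have hXL : ∀ p : ℝ, (fun t => X t ^ p) =O[atTop] (fun t => negLogW q t ^ (p / q)) := fun p =>
    ((isTheta_apxSolution_rpow hr hrq hX hXt p).1.trans (htT _)).trans (hTL _)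
  have hz : (fun t => X t ^ (r - q)) =O[atTop] (fun t => negLogW q t ^ (a - 1)) := by
    have := hXL (r - q)
    rwa [show (r - q) / q = a - 1 by rw [hadef]; field_simp] at this
  have hvpos := eventually_pos_of_near (by linarith) hX hv
  have hlogX : (fun t => q * Real.log (X t) - Real.log (2 * t))
      =O[atTop] (fun t => negLogW q t ^ (a - 1)) := by
    have h1 := isBigO_log (tendsto_rpow_zero_of_neg (show r - q < 0 by linarith) hX)
      (apxTime_div_sub_one hr hrq hX)
    refine (h1.neg_left.trans hz).congr' ?_ EventuallyEq.rfl
    filter_upwards [hXt, hX.eventually_gt_atTop 0, eventually_gt_atTop 0] with t ht hx ht0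
    rw [ht, Real.log_div (by positivity) (by positivity), Real.log_rpow hx]
    ring
  have hlogL : (fun t => Real.log (negLogW q t) - Real.log (2 * t))
      =O[atTop] (fun t => negLogW q t ^ (a - 1)) :=
    (isBigO_log_sub_log (by linarith) hT hLT).trans (hTL _)
  have hlogT : (fun t : ℝ => Real.log (2 * t + 1) - Real.log (2 * t))
      =O[atTop] (fun t => negLogW q t ^ (a - 1)) := by
    refine ((isBigO_log_sub_log (c := 0) zero_lt_one hT ?_).trans
      (isBigO_rpow_rpow (p' := a - 1) (by linarith) hT)).trans (hTL _)
    simp only [add_sub_cancel_left, Real.rpow_zero]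
    exact isBigO_refl _ _
  have hg : (fun t => v t ^ q + v t ^ r
      - (negLogW q t - (q - 1) / q * Real.log (negLogW q t) - Real.log q))
      =O[atTop] (fun t => negLogW q t ^ (a - 1)) := by
    have h1 := (nonlinearity_sub hr hrq hX hv).trans hz
    have hw : (fun t => X t ^ (-q)) =O[atTop] (fun t => negLogW q t ^ (a - 1)) :=
      (isBigO_rpow_rpow (by linarith) hX).trans hz
    -- In T(X) = 2t the term (2q-1) log X is ((2q-1)/q) log(2t) up to the error. One unit of log(2t)
    -- goes into L as log(2t+1), and the remaining fraction (q-1)/q becomes the log L term.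
    refine ((((((h1.sub (hz.const_mul_left (coeffA q r))).sub (hw.const_mul_left (coeffC q))).sub
      (hlogX.const_mul_left ((2 * q - 1) / q)))).add hlogT).add
      (hlogL.const_mul_left ((q - 1) / q))).congr' ?_ EventuallyEq.rfl
    filter_upwards [hXt] with t ht
    -- `leadConst q` is the reciprocal of (q'/4) · q: the factor q'/4 is the one in w, and q gives
    -- the term log(1/q).
    have hK : Real.log (leadConst q) = -Real.log (q / (q - 1) / 4) - Real.log q := by
      rw [← Real.log_inv, ← Real.log_div (by positivity) (by positivity)]
      congr 1
      unfold leadConst; field_simp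
    unfold apxTime at ht
    rw [hK] at ht
    have e1 : (2 * q - 1) / q = 1 + (q - 1) / q := by field_simp; ring
    have e2 : (2 * q - 1) / q * (q * Real.log (X t) - Real.log (2 * t))
        = (2 * q - 1) * Real.log (X t) - (1 + (q - 1) / q) * Real.log (2 * t) := by
      rw [← e1]; field_simp
    rw [e2]
    have hLdef : negLogW q t = 2 * t - Real.log (2 * t + 1) - Real.log (q / (q - 1) / 4) := rfl
    linear_combination hLdef - ht
  have hpow : ∀ᶠ t in atTop, v t ^ r = (v t ^ q) ^ a := by
    filter_upwards [hvpos] with t ht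
    rw [← Real.rpow_mul ht.le, hadef]; congr 1; field_simp
  have hvr : (fun t => v t ^ r) =O[atTop] (fun t => negLogW q t ^ a) :=
    (isTheta_rpow_of_near r (by linarith) hX hv).1.trans (hXL r)
  have hs : (fun t => v t ^ q - negLogW q t) =O[atTop] (fun t => negLogW q t ^ a) := by
    have h0 := isBigO_rpow_rpow ha0.le hL
    simp only [Real.rpow_zero] at h0
    have h1 := hg.trans (isBigO_rpow_rpow (p' := a) (by linarith) hL)
    refine (((h1.sub hvr).sub ((isBigO_log_rpow ha0 hL).const_mul_left ((q - 1) / q))).sub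
      ((isBigO_const_const (Real.log q) one_ne_zero _).trans h0)).congr_left fun t => ?_
    ring
  refine (rpow_sub_expansion (s := fun t => v t ^ q) hq hr hrq hL hs (hg.congr' ?_
    EventuallyEq.rfl)).congr' ?_ EventuallyEq.rfl
  · filter_upwards [hpow] with t ht
    rw [ht]
  · filter_upwards [hvpos] with t ht
    rw [← Real.rpow_mul ht.le, mul_one_div_cancel hq0.ne', Real.rpow_one]

end Expansion

/-! ### Return to the plane and the main theorem. -/

theorem tendsto_neg_log_norm : Tendsto (fun x : Plane => -Real.log ‖x‖) (𝓝[≠] 0) atTop :=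
  tendsto_neg_atBot_atTop.comp (Real.tendsto_log_nhdsGT_zero.comp tendsto_norm_nhdsNE_zero)

theorem neg_log_wFun {q : ℝ} (hq : 1 < q) {x : Plane} (hx : x ≠ 0) (hx1 : 0 < -Real.log ‖x‖) :
    -Real.log (wFun q x) = negLogW q (-Real.log ‖x‖) := by
  have hq1 : 0 < q - 1 := by linarith
  have hn : 0 < ‖x‖ := norm_pos_iff.2 hx
  have h1 : Real.log (1 / ‖x‖ ^ 2) = 2 * -Real.log ‖x‖ := by
    rw [one_div, Real.log_inv, Real.log_pow]; push_cast; ring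
  unfold wFun negLogW
  rw [h1, Real.log_mul (by positivity) (by positivity), Real.log_mul (by positivity)
    (by positivity), Real.log_pow]
  push_cast
  ring

theorem mainTheorem4 (q r : ℝ) (hq : 1 < q) (hr : 0 < r) (hrq : r < q / 2) :
    ∃ R : ℝ, 0 < R ∧ ∃ u : Plane → ℝ,
      IsSingularSolution (fun s : ℝ => Real.exp (s ^ q + s ^ r)) R u ∧
      ContDiffOn ℝ ∞ u (puncturedDisc R) ∧
      (∀ x ∈ puncturedDisc R, ∀ y ∈ puncturedDisc R, ‖x‖ = ‖y‖ → u x = u y) ∧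
      ∃ n : ℕ, 2 ≤ n ∧ 1 / (1 - r / q) < (n : ℝ) ∧ (n : ℝ) ≤ 1 / (1 - r / q) + 1 ∧
        (fun x : Plane => u x - expansion q r n (-Real.log (wFun q x)))
          =O[𝓝[≠] (0 : Plane)]
        (fun x : Plane => (-Real.log (wFun q x)) ^ (-(2 - 1 / q - r / q))) := by
  obtain ⟨t₁, X, v, v', hX, hXt, hvX, hv⟩ := exists_emden_solution hq hr hrq
  have hq0 : 0 < q := by linarith
  have ha : r / q < 1 / 2 := by rw [div_lt_iff₀ hq0]; linarith
  have ha0 : 0 < r / q := by positivity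
  have hmem : ∀ x ∈ puncturedDisc (Real.exp (-t₁)), x ≠ 0 ∧ t₁ < -Real.log ‖x‖ := by
    rintro x ⟨hx1, hx2⟩
    have hx0 : x ≠ 0 := hx2
    refine ⟨hx0, ?_⟩
    rw [mem_ball_zero_iff] at hx1
    have := (Real.log_lt_iff_lt_exp (norm_pos_iff.2 hx0)).2 hx1
    linarith
  have hsmooth : ContDiffOn ℝ ∞ v (Set.Ioi t₁) := by
    refine contDiffOn_of_second_order (v' := v')
      (Φ := fun t y => -Real.exp (y ^ q + y ^ r - 2 * t)) (S := {p : ℝ × ℝ | 0 < p.2})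
      (fun t ht => (hv t ht).2.1) (fun t ht => (hv t ht).2.2) (fun t ht => (hv t ht).1) ?_
    have hp : ∀ p : ℝ, ContDiffOn ℝ ∞ (fun z : ℝ × ℝ => z.2 ^ p) {z : ℝ × ℝ | 0 < z.2} := fun p =>
      contDiffOn_snd.rpow_const_of_ne fun z hz => ne_of_gt hz
    exact (((hp q).add (hp r)).sub (contDiffOn_const.mul contDiffOn_fst)).exp.neg
  have husmooth : ContDiffOn ℝ ∞ (fun x : Plane => v (-Real.log ‖x‖))
      (puncturedDisc (Real.exp (-t₁))) := by
    refine hsmooth.comp (f := fun x : Plane => -Real.log ‖x‖) ?_ fun x hx => (hmem x hx).2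
    refine (ContDiffOn.log ?_ fun x hx => norm_ne_zero_iff.2 (hmem x hx).1).neg
    exact contDiffOn_id.norm ℝ fun x hx => (hmem x hx).1
  -- The radius exp(-t₁) corresponds to t > t₁. Since 0 < r/q < 1/2, the number 1/(1 - r/q) lies
  -- between 1 and 2, so n = 2.
  refine ⟨Real.exp (-t₁), Real.exp_pos _, fun x => v (-Real.log ‖x‖), ⟨?_, ?_, ?_, ?_⟩, husmooth,
    fun x _ y _ hxy => by simp only [hxy], 2, le_rfl, ?_, ?_, ?_⟩
  · exact contDiffOn_infty.1 husmooth 2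
  · exact fun x hx => (hv _ (hmem x hx).2).1.le
  · intro x hx
    obtain ⟨hx0, hxt⟩ := hmem x hx
    rw [laplacian_comp_neg_log_norm (fun t ht => (hv t ht).2.1) (fun t ht => (hv t ht).2.2) hx0 hxt]
    have hn : 0 < ‖x‖ := norm_pos_iff.2 hx0
    have e1 : ‖x‖ ^ 2 = Real.exp (-(2 * -Real.log ‖x‖)) := by
      rw [show -(2 * -Real.log ‖x‖) = Real.log (‖x‖ ^ 2) by rw [Real.log_pow]; push_cast; ring,
        Real.exp_log (by positivity)]
    rw [e1, neg_div, neg_neg, ← Real.exp_sub]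
    congr 1
    ring
  · exact (tendsto_atTop_of_near (by linarith) hX hvX).comp tendsto_neg_log_norm
  · rw [div_lt_iff₀ (by linarith)]; push_cast; linarith
  · have : 1 ≤ 1 / (1 - r / q) := by rw [le_div_iff₀ (by linarith)]; linarith
    push_cast; linarith
  · have h := (emden_solution_expansion hq hr hrq hX hXt hvX).comp_tendsto tendsto_neg_log_norm
    have hw : ∀ᶠ x : Plane in 𝓝[≠] 0, -Real.log (wFun q x) = negLogW q (-Real.log ‖x‖) := by
      filter_upwards [self_mem_nhdsWithin, tendsto_neg_log_norm.eventually_gt_atTop 0] with x h1 h2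
      exact neg_log_wFun hq h1 h2
    refine h.congr' ?_ ?_
    · filter_upwards [hw] with x hx
      simp only [Function.comp, hx]
    · filter_upwards [hw] with x hx
      simp only [Function.comp, hx]
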